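/- Let $M$ be a smooth manifold, $(\mathcal A,[\,,],\rho)$ a Lie algebroid over $M$ (a real vector bundle with a Lie bracket on $\Gamma(\mathcal A)$ and a bundle map $\rho:\mathcal A\to TM$ such that $[X,fY]=f[X,Y]+(\rho(X)f)Y$), and $E$ a real vector bundle over $M$. Put $\Omega^k(\mathcal A,E)=\Gamma(\wedge^k\mathcal A^*\otimes E)$ and $\Omega^*(\mathcal A,E)=\bigoplus_{k\ge 0}\Omega^k(\mathcal A,E)$. Let $\mathrm{Sh}_{p,q}$ be the set of $(p,q)$-shuffles, i.e. permutations $\sigma$ of $\{1,\dots,p+q\}$ with $\sigma(1)<\dots<\sigma(p)$ and $\sigma(p+1)<\dots<\sigma(p+q)$. For $\phi\in\Omega^p(\mathcal A,\mathcal A)$ let $i_\phi$ be the operator on $\Omega^*(\mathcal A,E)$ that vanishes on $\Omega^0(\mathcal A,E)$ and is given on $s\in\Omega^{m+1}(\mathcal A,E)$ by $$(i_\phi s)(Z_1,\dots,Z_{p+m})=\sum_{\sigma\in \mathrm{Sh}_{p,m}}(-1)^\sigma s\big(\phi(Z_{\sigma(1)},\dots,Z_{\sigma(p)}),Z_{\sigma(p+1)},\dots,Z_{\sigma(p+m)}\big).$$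 An $\mathcal A$-connection on $E$ is an $\mathbb R$-bilinear map $\nabla:\Gamma(\mathcal A)\times\Gamma(E)\to\Gamma(E)$ with $\nabla_{fX}s=f\nabla_Xs$ and $\nabla_X(fs)=(\rho(X)f)s+f\nabla_Xs$ for all $f\in C^\infty(M)$. It defines an operator $d^\nabla$ on $\Omega^*(\mathcal A,E)$, given for $s\in\Omega^m(\mathcal A,E)$ by $$(d^\nabla s)(Z_1,\dots,Z_{m+1})=\sum_{\sigma\in \mathrm{Sh}_{1,m}}(-1)^\sigma\nabla_{Z_{\sigma(1)}}\big(s(Z_{\sigma(2)},\dots,Z_{\sigma(m+1)})\big)-\sum_{\sigma\in \mathrm{Sh}_{2,m-1}}(-1)^\sigma s\big([Z_{\sigma(1)},Z_{\sigma(2)}],Z_{\sigma(3)},\dots,Z_{\sigma(m+1)}\big),$$ where the second sum is empty for $m=0$. For operators $P$, $Q$ of degrees $a$, $b$ put $[P,Q]=PQ-(-1)^{ab}QP$. Let $\nabla$ be an $\mathcal A$-connection on $\mathcal A$ that is torsion-free, i.e. $\nabla_XY-\nabla_YX=[X,Y]$, and let $\nabla^E$ be an $\mathcal A$-connection on $E$.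 For $\phi\in\Omega^p(\mathcal A,\mathcal A)$ define the operator $\nabla_\phi$ of degree $p$ on $\Omega^*(\mathcal A,E)$ by $$\nabla_\phi=[i_\phi,d^{\nabla^E}]-(-1)^p\,i_{d^{\nabla}\phi},\qquad [i_\phi,d^{\nabla^E}]=i_\phi d^{\nabla^E}+(-1)^pd^{\nabla^E}i_\phi,$$ and define $\nabla_\phi$ on $\Omega^*(\mathcal A,\mathcal A)$ in the same way with $(E,\nabla^E)=(\mathcal A,\nabla)$. Then for all $k,l\ge 0$, $\phi\in\Omega^k(\mathcal A,\mathcal A)$ and $\psi\in\Omega^l(\mathcal A,\mathcal A)$, as operators on $\Omega^*(\mathcal A,E)$, $$[\nabla_\phi,i_\psi]=i_{\nabla_\phi\psi}-(-1)^{k(l-1)}\,\nabla_{i_\psi\phi},$$ where $[\nabla_\phi,i_\psi]=\nabla_\phi i_\psi-(-1)^{k(l-1)}i_\psi\nabla_\phi$, and $i_\psi\phi=0$ if $k=0$. -/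

import Mathlib

open scoped Manifold ContDiff
open Equiv (Perm)

namespace LieAlgebroidForms

section Shuffles

/-- `σ` is a `(p, n - p)`-shuffle of `Fin n`: it is increasing on the first `p` indices and
increasing on the remaining ones. -/
def IsShuffle (p : ℕ) {n : ℕ} (σ : Perm (Fin n)) : Prop :=
  (∀ i j : Fin n, i < j → j.val < p → σ i < σ j) ∧
    (∀ i j : Fin n, i < j → p ≤ i.val → σ i < σ j)

open Classical in
/-- The set `Sh_{p, q}` of shuffles of `Fin n`, where `p + q = n`. -/
noncomputable def shuffles (p q : ℕ) {n : ℕ} (_h : p + q = n) : Finset (Perm (Fin n)) :=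
  Finset.univ.filter (IsShuffle p)

/-- The `i`-th index of the first block of `Fin n`, `n = p + q`. -/
def fstIdx {p q n : ℕ} (h : p + q = n) (i : Fin p) : Fin n := Fin.cast h (Fin.castAdd q i)

/-- The `j`-th index of the second block of `Fin n`, `n = p + q`. -/
def sndIdx {p q n : ℕ} (h : p + q = n) (j : Fin q) : Fin n := Fin.cast h (Fin.natAdd p j)

variable {V N W : Type*} [AddCommGroup V] [Module ℝ V] [AddCommGroup N] [Module ℝ N]
  [AddCommGroup W] [Module ℝ W]

/-- The multilinear map `Z ↦ b (a (Z₁, …, Z_p)) (Z_{p+1}, …, Z_{p+q})`. -/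
def blockMap {p q n : ℕ} (h : p + q = n) (a : V [⋀^Fin p]→ₗ[ℝ] N)
    (b : N →ₗ[ℝ] V [⋀^Fin q]→ₗ[ℝ] W) : MultilinearMap ℝ (fun _ : Fin n => V) W :=
  ((((AlternatingMap.toMultilinearMapLM (R := ℝ) (S := ℝ) (M := V) (N := W)
      (ι := Fin q)).comp b).compMultilinearMap a.toMultilinearMap).uncurrySum).domDomCongr
        (finSumFinEquiv.trans (finCongr h))

theorem blockMap_apply {p q n : ℕ} (h : p + q = n) (a : V [⋀^Fin p]→ₗ[ℝ] N)
    (b : N →ₗ[ℝ] V [⋀^Fin q]→ₗ[ℝ] W) (Z : Fin n → V) :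
    blockMap h a b Z = b (a fun i => Z (fstIdx h i)) fun j => Z (sndIdx h j) := rfl

/-- The permutation of `Fin (p + q)` that acts by `α` on the first block and by `β` on the
second one. -/
def blockPerm (p q : ℕ) (s : Perm (Fin p) × Perm (Fin q)) : Perm (Fin (p + q)) :=
  finSumFinEquiv.permCongr (Equiv.Perm.sumCongr s.1 s.2)

theorem blockPerm_fst (p q : ℕ) (s : Perm (Fin p) × Perm (Fin q)) (i : Fin p) :
    blockPerm p q s (fstIdx rfl i) = fstIdx rfl (s.1 i) := by
  simp [blockPerm, fstIdx, Equiv.permCongr_apply]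

theorem blockPerm_snd (p q : ℕ) (s : Perm (Fin p) × Perm (Fin q)) (j : Fin q) :
    blockPerm p q s (sndIdx rfl j) = sndIdx rfl (s.2 j) := by
  simp [blockPerm, sndIdx, Equiv.permCongr_apply]

theorem blockPerm_sign (p q : ℕ) (s : Perm (Fin p) × Perm (Fin q)) :
    (Equiv.Perm.sign (blockPerm p q s)) = Equiv.Perm.sign s.1 * Equiv.Perm.sign s.2 := by
  simp [blockPerm]

theorem blockPerm_mul (p q : ℕ) (s t : Perm (Fin p) × Perm (Fin q)) :
    blockPerm p q (s * t) = blockPerm p q s * blockPerm p q t := by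
  apply Equiv.ext
  intro x
  obtain ⟨y, rfl⟩ := finSumFinEquiv.surjective x
  rcases y with y | y <;> simp [blockPerm, Equiv.permCongr_apply]

theorem isShuffle_iff {p q : ℕ} (σ : Perm (Fin (p + q))) :
    IsShuffle p σ ↔ StrictMono (fun i : Fin p => σ (fstIdx rfl i)) ∧
      StrictMono (fun j : Fin q => σ (sndIdx rfl j)) := by
  constructor
  · rintro ⟨h1, h2⟩
    refine ⟨fun i j hij => h1 _ _ ?_ ?_, fun i j hij => h2 _ _ ?_ ?_⟩
    · exact hij
    · simp [fstIdx]
    · simpa [sndIdx] using hij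
    · simp [sndIdx]
  · rintro ⟨h1, h2⟩
    constructor
    · intro i j hij hj
      have hij' : i.val < j.val := hij
      have := @h1 ⟨i, by omega⟩ ⟨j, hj⟩ hij'
      exact this
    · intro i j hij hi
      have hij' : i.val < j.val := hij
      have key : ∀ (i : Fin (p + q)) (hi : p ≤ i.val),
          sndIdx (n := p + q) rfl (⟨i.val - p, by omega⟩ : Fin q) = i := by
        intro i hi
        apply Fin.ext
        simp [sndIdx]
        omega
      have h := @h2 ⟨i.val - p, by omega⟩ ⟨j.val - p, by omega⟩ (by
        simp only [Fin.mk_lt_mk]; omega)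
      simp only [key i hi, key j (by omega)] at h
      exact h

theorem perm_eq_one_of_strictMono {m n : ℕ} {f : Fin m → Fin n} (α : Perm (Fin m))
    (hf : StrictMono f) (hg : StrictMono fun i => f (α i)) : α = 1 := by
  have hα : StrictMono α := fun i j hij => by
    have := hg hij
    exact hf.lt_iff_lt.1 this
  have h : (StrictMono.orderIsoOfSurjective α hα α.surjective) = OrderIso.refl _ :=
    Subsingleton.elim _ _
  apply Equiv.ext
  intro i
  have := congrArg (fun e => e i) h
  simpa using this

/-- Summing over all permutations counts every shuffle `p! q!` times. -/
theorem sum_perm_eq_sum_shuffles {p q n : ℕ} (h : p + q = n) (a : V [⋀^Fin p]→ₗ[ℝ] N)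
    (b : N →ₗ[ℝ] V [⋀^Fin q]→ₗ[ℝ] W) (Z : Fin n → V) :
    ∑ σ : Perm (Fin n), Equiv.Perm.sign σ • blockMap h a b (fun i => Z (σ i)) =
      (p.factorial * q.factorial) •
        ∑ σ ∈ shuffles p q h, Equiv.Perm.sign σ • blockMap h a b (fun i => Z (σ i)) := by
  subst h
  have hcard : p.factorial * q.factorial =
      (Finset.univ : Finset (Perm (Fin p) × Perm (Fin q))).card := by
    simp [Fintype.card_perm]
  rw [hcard, Finset.smul_sum]
  simp_rw [← Finset.sum_const]
  rw [← Finset.sum_product']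
  symm
  refine Finset.sum_bij (fun x _ => x.1 * blockPerm p q x.2) (fun _ _ => Finset.mem_univ _)
    ?_ ?_ ?_
  · rintro ⟨σ, s⟩ hσ ⟨τ, t⟩ hτ heq
    simp only [Finset.mem_product, shuffles, Finset.mem_filter, Finset.mem_univ, true_and,
      and_true, isShuffle_iff] at hσ hτ heq
    have h1 : σ = τ * blockPerm p q (t * s⁻¹) := by
      have h2 : blockPerm p q s * blockPerm p q s⁻¹ = 1 := by
        rw [← blockPerm_mul, mul_inv_cancel]
        apply Equiv.ext
        intro x
        simp [blockPerm, Equiv.permCongr_apply]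
      rw [blockPerm_mul, ← mul_assoc, ← heq, mul_assoc, h2, mul_one]
    have h3 : t * s⁻¹ = 1 := by
      apply Prod.ext
      · apply perm_eq_one_of_strictMono _ hτ.1
        have := hσ.1
        rw [h1] at this
        simpa only [Equiv.Perm.mul_apply, blockPerm_fst] using this
      · apply perm_eq_one_of_strictMono _ hτ.2
        have := hσ.2
        rw [h1] at this
        simpa only [Equiv.Perm.mul_apply, blockPerm_snd] using this
    have h4 : t = s := by rwa [mul_inv_eq_one] at h3
    subst h4
    rw [mul_left_inj] at heq
    rw [heq]
  · intro π _
    set f : Fin p → Fin (p + q) := fun i => π (fstIdx rfl i) with hf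
    set g : Fin q → Fin (p + q) := fun j => π (sndIdx rfl j) with hg
    have hfi : Function.Injective f := π.injective.comp (fun i j hij => by
      simpa [fstIdx] using hij)
    have hgi : Function.Injective g := π.injective.comp (fun i j hij => by
      simpa [sndIdx] using hij)
    refine ⟨(π * blockPerm p q (Tuple.sort f, Tuple.sort g),
      ((Tuple.sort f)⁻¹, (Tuple.sort g)⁻¹)), ?_, ?_⟩
    · simp only [Finset.mem_product, shuffles, Finset.mem_filter, Finset.mem_univ, true_and,
        and_true, isShuffle_iff, Equiv.Perm.mul_apply, blockPerm_fst, blockPerm_snd]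
      exact ⟨(Tuple.monotone_sort f).strictMono_of_injective
          (hfi.comp (Tuple.sort f).injective),
        (Tuple.monotone_sort g).strictMono_of_injective (hgi.comp (Tuple.sort g).injective)⟩
    · simp only
      rw [mul_assoc, ← blockPerm_mul]
      have : ((Tuple.sort f, Tuple.sort g) * ((Tuple.sort f)⁻¹, (Tuple.sort g)⁻¹) :
          Perm (Fin p) × Perm (Fin q)) = 1 := by
        apply Prod.ext <;> simp
      rw [this]
      apply Equiv.ext
      intro x
      simp [blockPerm, Equiv.permCongr_apply]
  · rintro ⟨σ, s⟩ _
    simp only [blockMap_apply, Equiv.Perm.mul_apply, blockPerm_fst, blockPerm_snd,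
      Equiv.Perm.sign_mul, blockPerm_sign]
    have ha := a.map_perm (fun i => Z (σ (fstIdx rfl i))) s.1
    have hb : ∀ y, b y (fun j => Z (σ (sndIdx rfl (s.2 j)))) =
        Equiv.Perm.sign s.2 • b y (fun j => Z (σ (sndIdx rfl j))) := fun y =>
      (b y).map_perm (fun j => Z (σ (sndIdx rfl j))) s.2
    simp only [Function.comp_def] at ha
    rw [hb, ha]
    rcases Int.units_eq_one_or (Equiv.Perm.sign s.1) with h1 | h1 <;>
    rcases Int.units_eq_one_or (Equiv.Perm.sign s.2) with h2 | h2 <;>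
    simp [h1, h2, Units.smul_def]

/-- The alternating map
`Z ↦ ∑_{σ ∈ Sh_{p,q}} (-1)^σ b (a (Z_{σ(1)}, …, Z_{σ(p)})) (Z_{σ(p+1)}, …, Z_{σ(p+q)})`. -/
noncomputable def shuffleSum {p q n : ℕ} (h : p + q = n) (a : V [⋀^Fin p]→ₗ[ℝ] N)
    (b : N →ₗ[ℝ] V [⋀^Fin q]→ₗ[ℝ] W) : V [⋀^Fin n]→ₗ[ℝ] W where
  toFun Z := ∑ σ ∈ shuffles p q h, Equiv.Perm.sign σ •
    b (a fun i => Z (σ (fstIdx h i))) fun j => Z (σ (sndIdx h j))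
  map_update_add' {inst} Z i x y := by
    obtain rfl : inst = instDecidableEqFin n := Subsingleton.elim _ _
    have := (∑ σ ∈ shuffles p q h, Equiv.Perm.sign σ •
      (blockMap h a b).domDomCongr σ).map_update_add Z i x y
    simpa only [sum_apply, _root_.smul_apply, MultilinearMap.domDomCongr_apply,
      blockMap_apply] using this
  map_update_smul' {inst} Z i c x := by
    obtain rfl : inst = instDecidableEqFin n := Subsingleton.elim _ _
    have := (∑ σ ∈ shuffles p q h, Equiv.Perm.sign σ •
      (blockMap h a b).domDomCongr σ).map_update_smul Z i c x
    simpa only [sum_apply, _root_.smul_apply, MultilinearMap.domDomCongr_apply,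
      blockMap_apply] using this
  map_eq_zero_of_eq' Z i j hZ hij := by
    have h1 := sum_perm_eq_sum_shuffles h a b Z
    have h2 := (MultilinearMap.alternatization (blockMap h a b)).map_eq_zero_of_eq Z hZ hij
    rw [MultilinearMap.alternatization_apply] at h2
    have h3 : (p.factorial * q.factorial) •
        ∑ σ ∈ shuffles p q h, Equiv.Perm.sign σ • blockMap h a b (fun i => Z (σ i)) = 0 := by
      rw [← h1]; exact h2
    rw [← Nat.cast_smul_eq_nsmul ℝ, smul_eq_zero] at h3
    rcases h3 with h3 | h3
    · exact absurd h3 (by positivity)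
    · exact h3

theorem shuffleSum_apply {p q n : ℕ} (h : p + q = n) (a : V [⋀^Fin p]→ₗ[ℝ] N)
    (b : N →ₗ[ℝ] V [⋀^Fin q]→ₗ[ℝ] W) (Z : Fin n → V) :
    shuffleSum h a b Z = ∑ σ ∈ shuffles p q h, Equiv.Perm.sign σ •
      b (a fun i => Z (σ (fstIdx h i))) fun j => Z (σ (sndIdx h j)) := rfl

end Shuffles

noncomputable section Sections

variable {EM : Type*} [NormedAddCommGroup EM] [NormedSpace ℝ EM]
  {H : Type*} [TopologicalSpace H] (I : ModelWithCorners ℝ EM H)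
  (M : Type*) [TopologicalSpace M] [ChartedSpace H M]

/-- The ring `C^∞(M)`. -/
abbrev SmoothFun := C^∞⟮I, M; 𝓘(ℝ, ℝ), ℝ⟯

variable {M}
variable (F : Type*) [NormedAddCommGroup F] [NormedSpace ℝ F]
  (A : M → Type*) [TopologicalSpace (Bundle.TotalSpace F A)]
  [∀ x, AddCommGroup (A x)] [∀ x, Module ℝ (A x)] [∀ x, TopologicalSpace (A x)]
  [FiberBundle F A] [VectorBundle ℝ F A]

/-- The space `Γ(A)` of smooth sections of the vector bundle `A`. -/
abbrev Sec := Cₛ^∞⟮I; F, A⟯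

variable {I F A}

/-- Multiplication of a smooth section by a smooth function. -/
instance : SMul (SmoothFun I M) (Sec I F A) :=
  ⟨fun f s => ⟨fun x => f x • s x, f.contMDiff.smul_section s.contMDiff⟩⟩

theorem fun_smul_apply (f : SmoothFun I M) (s : Sec I F A) (x : M) : (f • s) x = f x • s x := rfl

variable [FiniteDimensional ℝ EM] [T2Space M] [IsManifold I ∞ M]
  [FiniteDimensional ℝ F] [ContMDiffVectorBundle ∞ F A I]

open Bundle in
/-- Around any point there is a family of global smooth sections which is, near the point and
after multiplication by a cut-off function, a local frame. -/
theorem exists_global_frame (x : M) :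
    ∃ (ι : Type) (_ : Fintype ι) (g : ι → Sec I F A),
      (∀ v : A x, ∃ c : ι → ℝ, v = ∑ i, c i • g i x) ∧
      (∀ W : Sec I F A, W x = 0 → ∃ (c : ι → SmoothFun I M) (r : SmoothFun I M),
        (∀ i, c i x = 0) ∧ r x = 0 ∧ W = ∑ i, c i • g i + r • W) := by
  classical
  have hv1 : ContMDiffVectorBundle 1 F A I := ContMDiffVectorBundle.of_le (n := ∞) (by simp)
  let e := trivializationAt F A x
  have hx : x ∈ e.baseSet := FiberBundle.mem_baseSet_trivializationAt F A x
  let b := Module.finBasis ℝ F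
  obtain ⟨χ, hχ, -⟩ := (SmoothBumpFunction.nhds_basis_support (I := I)
    (e.open_baseSet.mem_nhds hx)).mem_iff.1 (e.open_baseSet.mem_nhds hx)
  have hχ0 : ∀ y, y ∉ e.baseSet → χ y = 0 := fun y hy =>
    image_eq_zero_of_notMem_tsupport fun h => hy (hχ h)
  let g : Fin (Module.finrank ℝ F) → Sec I F A := fun i =>
    ⟨(χ : M → ℝ) • e.localFrame b i, ContMDiffOn.smul_section_of_tsupport χ.contMDiff.contMDiffOn
      e.open_baseSet hχ (e.contMDiffOn_localFrame_baseSet ∞ b i)⟩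
  have hg : ∀ i y, g i y = χ y • e.localFrame b i y := fun i y => rfl
  refine ⟨Fin (Module.finrank ℝ F), inferInstance, g, ?_, ?_⟩
  · intro v
    refine ⟨fun i => (e.basisAt b hx).repr v i, ?_⟩
    simp only [hg, χ.eq_one, one_smul, e.localFrame_apply_of_mem_baseSet b hx]
    exact ((e.basisAt b hx).sum_repr v).symm
  · intro W hW
    let c : Fin (Module.finrank ℝ F) → SmoothFun I M := fun i =>
      ⟨fun y => χ y * e.localFrameCoeff I b i y (W y), by
        apply contMDiff_of_tsupport
        intro y hy
        have hy' : y ∈ e.baseSet := hχ (closure_mono (fun z hz => by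
          intro h0
          apply hz
          simp [h0]) hy)
        exact χ.contMDiffAt.mul (contMDiffAt_localFrameCoeff b hy' W.contMDiff.contMDiffAt i)⟩
    let r : SmoothFun I M := ⟨fun y => 1 - χ y * χ y,
      contMDiff_const.sub (χ.contMDiff.mul χ.contMDiff)⟩
    refine ⟨c, r, ?_, ?_, ?_⟩
    · intro i
      change χ x * e.localFrameCoeff I b i x (W x) = 0
      rw [hW, map_zero, mul_zero]
    · change 1 - χ x * χ x = 0
      rw [χ.eq_one]; norm_num
    · ext y
      have h1 : (∑ i, c i • g i + r • W) y =
          ∑ i, (χ y * e.localFrameCoeff I b i y (W y)) • (χ y • e.localFrame b i y) +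
            (1 - χ y * χ y) • W y := by
        have h2 : (∑ i, c i • g i + r • W) y = (∑ i, c i • g i : Sec I F A) y + (r • W) y := rfl
        have h3 : (∑ i, c i • g i : Sec I F A) y = ∑ i, (c i • g i) y := by
          have := congrFun (map_sum (ContMDiffSection.coeAddHom I F ∞ A)
            (fun i => c i • g i) Finset.univ) y
          exact this.trans (by rw [Finset.sum_apply]; rfl)
        rw [h2, h3]
        rfl
      rw [h1]
      by_cases hy : y ∈ e.baseSet
      · have h4 := e.eq_sum_localFrameCoeff_smul (I := I) (b := b) (s := W) hy
        have h5 : ∑ i, (χ y * e.localFrameCoeff I b i y (W y)) • (χ y • e.localFrame b i y) =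
            (χ y * χ y) • W y := by
          conv_rhs => rw [h4]
          rw [Finset.smul_sum]
          refine Finset.sum_congr rfl fun i _ => ?_
          simp only [smul_smul]
          congr 1
          ring
        rw [h5, ← add_smul]
        simp
      · simp [hχ0 y hy]

/-- The evaluation of smooth sections at a point. -/
def evalAt (x : M) : Sec I F A →ₗ[ℝ] A x where
  toFun s := s x
  map_add' _ _ := rfl
  map_smul' _ _ := rfl

theorem evalAt_surjective (x : M) : Function.Surjective (evalAt (I := I) (F := F) (A := A) x) := by
  intro v
  obtain ⟨ι, _, g, hg, -⟩ := exists_global_frame (I := I) (F := F) (A := A) x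
  obtain ⟨c, rfl⟩ := hg v
  exact ⟨∑ i, c i • g i, by rw [map_sum]; rfl⟩

/-- A `C^∞(M)`-linear functional with values in the fibre at `x` only depends on the value of
its argument at `x`. -/
theorem eq_zero_of_tensorial {Q : Type*} [AddCommGroup Q] [Module ℝ Q] (x : M)
    (L : Sec I F A →ₗ[ℝ] Q) (hL : ∀ (f : SmoothFun I M) (s : Sec I F A), L (f • s) = f x • L s)
    (W : Sec I F A) (hW : W x = 0) : L W = 0 := by
  obtain ⟨ι, _, g, -, hg⟩ := exists_global_frame (I := I) (F := F) (A := A) x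
  obtain ⟨c, r, hc, hr, h⟩ := hg W hW
  rw [h, map_add, map_sum]
  simp [hL, hc, hr]

/-- A linear choice of global smooth sections through the points of a fibre. -/
def sectionThrough (x : M) : A x →ₗ[ℝ] Sec I F A :=
  ((evalAt (I := I) (F := F) (A := A) x).exists_rightInverse_of_surjective
    (LinearMap.range_eq_top.2 (evalAt_surjective x))).choose

theorem sectionThrough_apply (x : M) (v : A x) :
    (sectionThrough (I := I) (F := F) (A := A) x v) x = v :=
  LinearMap.congr_fun ((evalAt (I := I) (F := F) (A := A) x).exists_rightInverse_of_surjective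
    (LinearMap.range_eq_top.2 (evalAt_surjective x))).choose_spec v

end Sections

set_option linter.unusedSectionVars false

noncomputable section Algebroids

variable {EM : Type*} [NormedAddCommGroup EM] [NormedSpace ℝ EM]
  {H : Type*} [TopologicalSpace H] (I : ModelWithCorners ℝ EM H)
  {M : Type*} [TopologicalSpace M] [ChartedSpace H M] [IsManifold I ∞ M]
  (F : Type*) [NormedAddCommGroup F] [NormedSpace ℝ F]
  (A : M → Type*) [TopologicalSpace (Bundle.TotalSpace F A)]
  [∀ x, AddCommGroup (A x)] [∀ x, Module ℝ (A x)] [∀ x, TopologicalSpace (A x)]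
  [FiberBundle F A] [VectorBundle ℝ F A]

/-- A smooth morphism of vector bundles `ρ : A → TM` over the identity of `M`. -/
structure AnchorMap where
  /-- The linear map `ρ x : A x → T_x M`. -/
  toFun : ∀ x : M, A x →ₗ[ℝ] TangentSpace I x
  smooth : ContMDiff (I.prod 𝓘(ℝ, F)) I.tangent ∞
    (fun v : Bundle.TotalSpace F A => (⟨v.proj, toFun v.proj v.snd⟩ : TangentBundle I M))

variable {I F A}

/-- The derivative `ρ(X) f` of a smooth function `f` along the vector field `ρ(X)`. -/
def AnchorMap.deriv (ρ : AnchorMap I F A) (X : Sec I F A) (f : SmoothFun I M) :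
    SmoothFun I M :=
  ⟨fun x => (mfderiv I 𝓘(ℝ, ℝ) f x (ρ.toFun x (X x)) : ℝ), by
    have h1 : ContMDiff I I.tangent ∞
        (fun x => (⟨x, ρ.toFun x (X x)⟩ : TangentBundle I M)) := ρ.smooth.comp X.contMDiff
    have h2 : ContMDiff I.tangent 𝓘(ℝ, ℝ).tangent ∞ (tangentMap I 𝓘(ℝ, ℝ) f) :=
      f.contMDiff.contMDiff_tangentMap (by simp)
    have h3 := (contMDiff_snd_tangentBundle_modelSpace (n := ∞) ℝ 𝓘(ℝ, ℝ)).comp (h2.comp h1)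
    exact h3⟩

variable (I F A) in
/-- A Lie algebroid structure `([ , ], ρ)` on the vector bundle `A` over `M`: a real Lie algebra
structure on `Γ(A)` and an anchor `ρ : A → TM`, related by the Leibniz rule. -/
structure LieAlgebroid where
  /-- The anchor. -/
  anchor : AnchorMap I F A
  /-- The Lie bracket on `Γ(A)`. -/
  bracket : Sec I F A →ₗ[ℝ] Sec I F A →ₗ[ℝ] Sec I F A
  bracket_self : ∀ X, bracket X X = 0
  jacobi : ∀ X Y Z, bracket X (bracket Y Z) + bracket Y (bracket Z X) +
    bracket Z (bracket X Y) = 0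
  leibniz : ∀ X Y (f : SmoothFun I M),
    bracket X (f • Y) = f • bracket X Y + anchor.deriv X f • Y

variable (F' : Type*) [NormedAddCommGroup F'] [NormedSpace ℝ F']
  (E : M → Type*) [TopologicalSpace (Bundle.TotalSpace F' E)]
  [∀ x, AddCommGroup (E x)] [∀ x, Module ℝ (E x)] [∀ x, TopologicalSpace (E x)]
  [FiberBundle F' E] [VectorBundle ℝ F' E]

/-- An `A`-connection `∇ : Γ(A) × Γ(E) → Γ(E)` on the vector bundle `E`. -/
structure AConnection (L : LieAlgebroid I F A) where
  /-- The covariant derivative `∇_X s`. -/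
  cov : Sec I F A →ₗ[ℝ] Sec I F' E →ₗ[ℝ] Sec I F' E
  cov_smul : ∀ (f : SmoothFun I M) X s, cov (f • X) s = f • cov X s
  leibniz : ∀ (f : SmoothFun I M) X s,
    cov X (f • s) = L.anchor.deriv X f • s + f • cov X s

/-- `∇_X Y - ∇_Y X = [X, Y]`. -/
def AConnection.TorsionFree {L : LieAlgebroid I F A} (nab : AConnection F A L) : Prop :=
  ∀ X Y, nab.cov X Y - nab.cov Y X = L.bracket X Y

variable (I F A)

/-- `Ω^k(A, E) = Γ(⋀^k A^* ⊗ E)`: families of skew-symmetric `k`-linear maps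
`A x × ⋯ × A x → E x` that depend smoothly on `x`, in the sense that they take smooth sections to
smooth sections. -/
def Forms (k : ℕ) : Submodule ℝ (∀ x : M, A x [⋀^Fin k]→ₗ[ℝ] E x) where
  carrier := {η | ∀ Z : Fin k → Sec I F A, ContMDiff I (I.prod 𝓘(ℝ, F')) ∞
    fun x => Bundle.TotalSpace.mk' F' x (η x fun i => Z i x)}
  add_mem' h1 h2 Z := (h1 Z).add_section (h2 Z)
  zero_mem' _ := Bundle.contMDiff_zeroSection ℝ E
  smul_mem' _ _ h Z := (h Z).const_smul_section

/-- The graded space `Ω^*(A, E) = ⨁_k Ω^k(A, E)`. -/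
def AllForms := DirectSum ℕ fun k => Forms I F A F' E k

instance : AddCommGroup (AllForms I F A F' E) :=
  inferInstanceAs (AddCommGroup (DirectSum ℕ fun k => Forms I F A F' E k))

instance : Module ℝ (AllForms I F A F' E) :=
  inferInstanceAs (Module ℝ (DirectSum ℕ fun k => Forms I F A F' E k))

variable {I F A F' E} in
/-- The inclusion `Ω^k(A, E) → Ω^*(A, E)`. -/
def ofForm (k : ℕ) : Forms I F A F' E k →ₗ[ℝ] AllForms I F A F' E :=
  DirectSum.lof ℝ ℕ (fun k => Forms I F A F' E k) k

variable {I F A F' E} in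
/-- The linear map on `Ω^*(A, E)` with prescribed restrictions to the spaces `Ω^k(A, E)`. -/
def liftForms {W : Type*} [AddCommGroup W] [Module ℝ W]
    (f : ∀ k, Forms I F A F' E k →ₗ[ℝ] W) : AllForms I F A F' E →ₗ[ℝ] W :=
  DirectSum.toModule ℝ ℕ W f

variable {I F A F' E} in
theorem liftForms_ofForm {W : Type*} [AddCommGroup W] [Module ℝ W]
    (f : ∀ k, Forms I F A F' E k →ₗ[ℝ] W) (k : ℕ) (η : Forms I F A F' E k) :
    liftForms f (ofForm k η) = f k η :=
  DirectSum.toModule_lof (R := ℝ) (φ := f) k η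

variable {I F A F' E} in
theorem allForms_hom_ext {W : Type*} [AddCommGroup W] [Module ℝ W]
    {f g : AllForms I F A F' E →ₗ[ℝ] W} (h : ∀ k η, f (ofForm k η) = g (ofForm k η)) : f = g :=
  DirectSum.linearMap_ext ℝ fun k => LinearMap.ext fun η => h k η

variable {I F A F' E}

/-- The value `η(Z₁, …, Z_k) ∈ Γ(E)` of a form on sections of `A`. -/
def onSections {k : ℕ} (η : Forms I F A F' E k) :
    Sec I F A [⋀^Fin k]→ₗ[ℝ] Sec I F' E where
  toFun Z := ⟨fun x => η.1 x fun i => Z i x, η.2 Z⟩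
  map_update_add' {inst} Z i X Y := by
    ext x
    have key : ∀ T : Sec I F A, (fun j => Function.update Z i T j x) =
        Function.update (fun j => Z j x) i (T x) := fun T => by
      funext j; by_cases h : j = i
      · subst h; simp
      · simp [h]
    change η.1 x (fun j => Function.update Z i (X + Y) j x) =
      η.1 x (fun j => Function.update Z i X j x) + η.1 x (fun j => Function.update Z i Y j x)
    rw [key, key, key]
    exact (η.1 x).map_update_add _ i _ _
  map_update_smul' {inst} Z i c X := by
    ext x
    have key : ∀ T : Sec I F A, (fun j => Function.update Z i T j x) =
        Function.update (fun j => Z j x) i (T x) := fun T => by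
      funext j; by_cases h : j = i
      · subst h; simp
      · simp [h]
    change η.1 x (fun j => Function.update Z i (c • X) j x) =
      c • η.1 x (fun j => Function.update Z i X j x)
    rw [key, key]
    exact (η.1 x).map_update_smul _ i _ _
  map_eq_zero_of_eq' Z i j hZ hij := by
    ext x
    exact (η.1 x).map_eq_zero_of_eq _ (by simp only [hZ]) hij

theorem onSections_apply {k : ℕ} (η : Forms I F A F' E k) (Z : Fin k → Sec I F A) (x : M) :
    onSections η Z x = η.1 x fun i => Z i x := rfl

/-- `C^∞(M)`-multilinearity of a map on sections. -/
def IsTensorial {k : ℕ} (T : Sec I F A [⋀^Fin k]→ₗ[ℝ] Sec I F' E) : Prop :=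
  ∀ (Z : Fin k → Sec I F A) (i : Fin k) (f : SmoothFun I M),
    T (Function.update Z i (f • Z i)) = f • T Z

theorem onSections_isTensorial {k : ℕ} (η : Forms I F A F' E k) : IsTensorial (onSections η) := by
  intro Z i f
  ext x
  have key : (fun j => Function.update Z i (f • Z i) j x) =
      Function.update (fun j => Z j x) i (f x • Z i x) := by
    funext j; by_cases h : j = i
    · subst h; simp [fun_smul_apply]
    · simp [h]
  rw [fun_smul_apply, onSections_apply, key, AlternatingMap.map_update_smul,
    Function.update_eq_self]
  rfl

/-- The alternating map `(X, Y) ↦ [X, Y]`. -/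
def LieAlgebroid.bracketAlt (L : LieAlgebroid I F A) :
    Sec I F A [⋀^Fin 2]→ₗ[ℝ] Sec I F A where
  toFun Z := L.bracket (Z 0) (Z 1)
  map_update_add' {inst} Z i X Y := by
    obtain rfl : inst = instDecidableEqFin 2 := Subsingleton.elim _ _
    fin_cases i <;> simp
  map_update_smul' {inst} Z i c X := by
    obtain rfl : inst = instDecidableEqFin 2 := Subsingleton.elim _ _
    fin_cases i <;> simp
  map_eq_zero_of_eq' Z i j hZ hij := by
    fin_cases i <;> fin_cases j <;> simp_all [L.bracket_self]

theorem LieAlgebroid.bracket_skew (L : LieAlgebroid I F A) (X Y : Sec I F A) :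
    L.bracket X Y = -L.bracket Y X := by
  have h := L.bracket_self (X + Y)
  simp only [map_add, LinearMap.add_apply, L.bracket_self, zero_add, add_zero] at h
  exact eq_neg_of_add_eq_zero_right h

variable {L : LieAlgebroid I F A}

/-- The first sum in the definition of `d^∇ η` on sections,
`∑_{σ ∈ Sh_{1,k}} (-1)^σ ∇_{Z_{σ(1)}} (η(Z_{σ(2)}, …, Z_{σ(k+1)}))`. -/
def covSum (nab : AConnection F' E L) {k : ℕ} (η : Sec I F A [⋀^Fin k]→ₗ[ℝ] Sec I F' E) :
    Sec I F A [⋀^Fin (k + 1)]→ₗ[ℝ] Sec I F' E :=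
  shuffleSum (Nat.add_comm 1 k) (AlternatingMap.ofSubsingleton ℝ _ _ (0 : Fin 1) LinearMap.id)
    { toFun := fun X => (nab.cov X).compAlternatingMap η
      map_add' := fun X Y => by ext; simp
      map_smul' := fun c X => by ext; simp }

/-- The second sum in the definition of `d^∇ η` on sections,
`∑_{σ ∈ Sh_{2,k-1}} (-1)^σ η([Z_{σ(1)}, Z_{σ(2)}], Z_{σ(3)}, …, Z_{σ(k+1)})`; it is empty for
`k = 0`. -/
def bracketSum (L : LieAlgebroid I F A) : {k : ℕ} →
    (Sec I F A [⋀^Fin k]→ₗ[ℝ] Sec I F' E) → Sec I F A [⋀^Fin (k + 1)]→ₗ[ℝ] Sec I F' E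
  | 0, _ => 0
  | q + 1, η => shuffleSum (Nat.add_comm 2 q) L.bracketAlt η.curryLeft

theorem covSum_apply (nab : AConnection F' E L) {k : ℕ}
    (η : Sec I F A [⋀^Fin k]→ₗ[ℝ] Sec I F' E) (Z : Fin (k + 1) → Sec I F A) :
    covSum nab η Z = ∑ σ ∈ shuffles 1 k (Nat.add_comm 1 k), Equiv.Perm.sign σ •
      nab.cov (Z (σ (fstIdx (Nat.add_comm 1 k) 0)))
        (η fun j => Z (σ (sndIdx (Nat.add_comm 1 k) j))) := rfl

theorem bracketSum_apply {q : ℕ}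
    (η : Sec I F A [⋀^Fin (q + 1)]→ₗ[ℝ] Sec I F' E) (Z : Fin (q + 1 + 1) → Sec I F A) :
    bracketSum L η Z = ∑ σ ∈ shuffles 2 q (Nat.add_comm 2 q), Equiv.Perm.sign σ •
      η (Fin.cons (L.bracket (Z (σ (fstIdx (Nat.add_comm 2 q) 0)))
          (Z (σ (fstIdx (Nat.add_comm 2 q) 1))))
        fun j => Z (σ (sndIdx (Nat.add_comm 2 q) j))) := rfl

theorem factorial_smul_covSum (nab : AConnection F' E L) {k : ℕ}
    (η : Sec I F A [⋀^Fin k]→ₗ[ℝ] Sec I F' E) (Z : Fin (k + 1) → Sec I F A) :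
    k.factorial • covSum nab η Z = ∑ σ : Perm (Fin (k + 1)), Equiv.Perm.sign σ •
      nab.cov (Z (σ 0)) (η fun j => Z (σ j.succ)) := by
  have h := sum_perm_eq_sum_shuffles (Nat.add_comm 1 k)
    (AlternatingMap.ofSubsingleton ℝ _ _ (0 : Fin 1) LinearMap.id)
    { toFun := fun X => (nab.cov X).compAlternatingMap η
      map_add' := fun X Y => by ext; simp
      map_smul' := fun c X => by ext; simp } Z
  have hs : ∀ j, sndIdx (Nat.add_comm 1 k) j = j.succ := fun j => by
    apply Fin.ext; simp [sndIdx]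
  have hf : fstIdx (Nat.add_comm 1 k) 0 = 0 := by apply Fin.ext; simp [fstIdx]
  rw [Nat.factorial_one, one_mul] at h
  refine h.symm.trans (Finset.sum_congr rfl fun σ _ => ?_)
  rw [blockMap_apply]
  simp only [hs]
  simp [hf]

theorem factorial_smul_bracketSum {q : ℕ}
    (η : Sec I F A [⋀^Fin (q + 1)]→ₗ[ℝ] Sec I F' E) (Z : Fin (q + 1 + 1) → Sec I F A) :
    (2 * q.factorial) • bracketSum L η Z =
      ∑ σ : Perm (Fin (q + 1 + 1)), Equiv.Perm.sign σ •
        η (Fin.cons (L.bracket (Z (σ 0)) (Z (σ 1))) fun j : Fin q => Z (σ j.succ.succ)) := by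
  have h := sum_perm_eq_sum_shuffles (Nat.add_comm 2 q) L.bracketAlt η.curryLeft Z
  have hs : ∀ j, sndIdx (Nat.add_comm 2 q) j = j.succ.succ := fun j => by
    apply Fin.ext; simp [sndIdx]
  have hf : fstIdx (Nat.add_comm 2 q) 0 = 0 := by apply Fin.ext; simp [fstIdx]
  have hf1 : fstIdx (Nat.add_comm 2 q) 1 = 1 := by apply Fin.ext; simp [fstIdx]
  rw [Nat.factorial_two] at h
  refine h.symm.trans (Finset.sum_congr rfl fun σ _ => ?_)
  rw [blockMap_apply]
  simp only [hs]
  change _ • η (Fin.cons (L.bracket (Z (σ (fstIdx (Nat.add_comm 2 q) 0)))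
    (Z (σ (fstIdx (Nat.add_comm 2 q) 1)))) _) = _
  rw [hf, hf1]

/-- The correction term in the failure of `covSum` and `bracketSum` to be tensorial. -/
def corr (L : LieAlgebroid I F A) {q : ℕ} (η : Sec I F A [⋀^Fin (q + 1)]→ₗ[ℝ] Sec I F' E)
    (Z : Fin (q + 1 + 1) → Sec I F A) (f : SmoothFun I M) (σ : Perm (Fin (q + 1 + 1))) :
    Sec I F' E :=
  Equiv.Perm.sign σ • (L.anchor.deriv (Z (σ 0)) f • η fun j => Z (σ j.succ))

theorem smul_fun_units (u : ℤˣ) (f : SmoothFun I M) (s : Sec I F' E) :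
    u • (f • s) = f • (u • s) := by
  rcases Int.units_eq_one_or u with h | h
  · simp [h]
  · subst h
    ext x
    simp [fun_smul_apply]

theorem smul_fun_add (f : SmoothFun I M) (s t : Sec I F' E) : f • (s + t) = f • s + f • t := by
  ext x
  exact smul_add _ _ _

theorem smul_fun_sum {ι : Type*} (u : Finset ι) (f : SmoothFun I M) (s : ι → Sec I F' E) :
    f • ∑ i ∈ u, s i = ∑ i ∈ u, f • s i :=
  map_sum (AddMonoidHom.mk' (fun s : Sec I F' E => f • s) (smul_fun_add f)) s u

theorem smul_fun_const (f : SmoothFun I M) (c : ℝ) (s : Sec I F' E) :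
    f • (c • s) = c • (f • s) := by
  ext x
  exact smul_comm _ _ _

theorem smul_fun_neg (f : SmoothFun I M) (s : Sec I F' E) : f • (-s) = -(f • s) := by
  ext x
  exact smul_neg _ _

theorem isTensorial_update {k : ℕ} {η : Sec I F A [⋀^Fin k]→ₗ[ℝ] Sec I F' E}
    (hη : IsTensorial η) (Y : Fin k → Sec I F A) (j : Fin k) (f : SmoothFun I M)
    (Y' : Fin k → Sec I F A) (h1 : Y' j = f • Y j) (h2 : ∀ i, i ≠ j → Y' i = Y i) :
    η Y' = f • η Y := by
  rw [← hη Y j f]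
  congr 1
  funext i
  by_cases h : i = j
  · subst h; simp [h1]
  · simp [h, h2 i h]

theorem corr_mul_swap {q : ℕ} (η : Sec I F A [⋀^Fin (q + 1)]→ₗ[ℝ] Sec I F' E)
    (Z : Fin (q + 1 + 1) → Sec I F A) (f : SmoothFun I M) (σ : Perm (Fin (q + 1 + 1)))
    (t : Fin (q + 1)) :
    corr L η Z f (σ * Equiv.swap (1 : Fin (q + 1 + 1)) t.succ) = corr L η Z f σ := by
  have h1 : (1 : Fin (q + 1 + 1)) = (0 : Fin (q + 1)).succ := rfl
  by_cases ht : (0 : Fin (q + 1)) = t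
  · subst ht
    rw [h1, Equiv.swap_self]
    rfl
  · have hne : (1 : Fin (q + 1 + 1)) ≠ t.succ := by
      rw [h1]; exact fun h => ht (Fin.succ_injective _ h)
    have h0 : Equiv.swap (1 : Fin (q + 1 + 1)) t.succ 0 = 0 :=
      Equiv.swap_apply_of_ne_of_ne (by rw [h1]; exact (Fin.succ_ne_zero _).symm)
        (Fin.succ_ne_zero _).symm
    have hs : ∀ j : Fin (q + 1), Equiv.swap (1 : Fin (q + 1 + 1)) t.succ j.succ =
        (Equiv.swap 0 t j).succ := fun j => by
      rw [h1, (Fin.succ_injective _).map_swap]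
    have hsw := η.map_swap (fun j => Z (σ j.succ)) ht
    simp only [Function.comp_def] at hsw
    simp only [corr, Equiv.Perm.mul_apply, h0, hs, Equiv.Perm.sign_mul, Equiv.Perm.sign_swap hne,
      hsw, smul_fun_neg]
    simp

/-- The terms with `σ⁻¹ i ≠ 0` can all be moved to `σ⁻¹ i = 1`. -/
theorem sum_corr {q : ℕ} (η : Sec I F A [⋀^Fin (q + 1)]→ₗ[ℝ] Sec I F' E)
    (Z : Fin (q + 1 + 1) → Sec I F A) (f : SmoothFun I M) (i : Fin (q + 1 + 1)) :
    ∑ σ : Perm (Fin (q + 1 + 1)), (if σ 0 = i then 0 else corr L η Z f σ) =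
      (q + 1) • ∑ σ : Perm (Fin (q + 1 + 1)), (if σ 1 = i then corr L η Z f σ else 0) := by
  have h1 : ∀ σ : Perm (Fin (q + 1 + 1)), (if σ 0 = i then 0 else corr L η Z f σ) =
      ∑ t : Fin (q + 1), (if σ t.succ = i then corr L η Z f σ else 0) := by
    intro σ
    by_cases h : σ 0 = i
    · rw [if_pos h]
      symm
      refine Finset.sum_eq_zero fun t _ => if_neg fun h' => ?_
      exact Fin.succ_ne_zero t (σ.injective (h'.trans h.symm))
    · rw [if_neg h]
      have hne : σ.symm i ≠ 0 := fun h' => h (by rw [← h']; simp)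
      obtain ⟨t, ht⟩ := Fin.exists_succ_eq.2 hne
      rw [Finset.sum_eq_single t]
      · rw [if_pos (by rw [ht]; simp)]
      · intro s _ hst
        refine if_neg fun h' => hst ?_
        apply Fin.succ_injective
        rw [ht, ← h']
        simp
      · simp
  simp_rw [h1]
  rw [Finset.sum_comm]
  have h2 : ∀ t : Fin (q + 1), ∑ σ : Perm (Fin (q + 1 + 1)),
      (if σ t.succ = i then corr L η Z f σ else 0) =
      ∑ σ : Perm (Fin (q + 1 + 1)), (if σ 1 = i then corr L η Z f σ else 0) := by
    intro t
    refine Fintype.sum_equiv (Equiv.mulRight (Equiv.swap (1 : Fin (q + 1 + 1)) t.succ)) _ _ ?_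
    intro σ
    simp only [Equiv.coe_mulRight, Equiv.Perm.mul_apply, Equiv.swap_apply_left, corr_mul_swap]
  simp [h2]

theorem covSum_smul (nab : AConnection F' E L) {q : ℕ}
    {η : Sec I F A [⋀^Fin (q + 1)]→ₗ[ℝ] Sec I F' E} (hη : IsTensorial η)
    (Z : Fin (q + 1 + 1) → Sec I F A) (i : Fin (q + 1 + 1)) (f : SmoothFun I M) :
    q.factorial • covSum nab η (Function.update Z i (f • Z i)) =
      q.factorial • (f • covSum nab η Z) +
        ∑ σ : Perm (Fin (q + 1 + 1)), (if σ 1 = i then corr L η Z f σ else 0) := by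
  set Z' := Function.update Z i (f • Z i) with hZ'
  have hself : Z' i = f • Z i := by simp [hZ']
  have hother : ∀ j, j ≠ i → Z' j = Z j := fun j hj => by simp [hZ', hj]
  have h0 : (q + 1).factorial • covSum nab η Z' =
      (q + 1).factorial • (f • covSum nab η Z) +
      ∑ σ : Perm (Fin (q + 1 + 1)), (if σ 0 = i then 0 else corr L η Z f σ) := by
    have h1 : (q + 1).factorial • (f • covSum nab η Z) =
        f • ((q + 1).factorial • covSum nab η Z) := by
      rw [← Nat.cast_smul_eq_nsmul ℝ, ← Nat.cast_smul_eq_nsmul ℝ, smul_fun_const]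
    rw [h1, factorial_smul_covSum, factorial_smul_covSum, smul_fun_sum, ← Finset.sum_add_distrib]
    refine Finset.sum_congr rfl fun σ _ => ?_
    by_cases h : σ 0 = i
    · rw [if_pos h, add_zero, h, hself, nab.cov_smul, ← smul_fun_units, ← h]
      have : (fun j : Fin (q + 1) => Z' (σ j.succ)) = fun j => Z (σ j.succ) := by
        funext j
        apply hother
        rw [← h]
        exact fun h' => Fin.succ_ne_zero j (σ.injective h')
      rw [this]
    · rw [if_neg h, hother _ h]
      have hne : σ.symm i ≠ 0 := fun h' => h (by rw [← h']; simp)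
      obtain ⟨t, ht⟩ := Fin.exists_succ_eq.2 hne
      have ht' : σ t.succ = i := by rw [ht]; simp
      rw [isTensorial_update hη (fun j => Z (σ j.succ)) t f (fun j => Z' (σ j.succ))
        (by simp only [ht', hself]) (fun j hj => hother _ (by
          rw [← ht']
          exact fun h' => hj (Fin.succ_injective _ (σ.injective h'))))]
      rw [nab.leibniz, smul_add, smul_fun_units, add_comm, smul_fun_units]
      simp only [corr, smul_fun_units]
  rw [sum_corr, Nat.factorial_succ, mul_smul, mul_smul, ← smul_add] at h0
  rw [← Nat.cast_smul_eq_nsmul ℝ (q + 1), ← Nat.cast_smul_eq_nsmul ℝ (q + 1)] at h0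
  exact smul_right_injective _ (by positivity : ((q + 1 : ℕ) : ℝ) ≠ 0) h0

theorem bracketSum_smul {q : ℕ}
    {η : Sec I F A [⋀^Fin (q + 1)]→ₗ[ℝ] Sec I F' E} (hη : IsTensorial η)
    (Z : Fin (q + 1 + 1) → Sec I F A) (i : Fin (q + 1 + 1)) (f : SmoothFun I M) :
    q.factorial • bracketSum L η (Function.update Z i (f • Z i)) =
      q.factorial • (f • bracketSum L η Z) +
        ∑ σ : Perm (Fin (q + 1 + 1)), (if σ 1 = i then corr L η Z f σ else 0) := by
  set Z' := Function.update Z i (f • Z i) with hZ'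
  have hself : Z' i = f • Z i := by simp [hZ']
  have hother : ∀ j, j ≠ i → Z' j = Z j := fun j hj => by simp [hZ', hj]
  have hη0 : ∀ (f : SmoothFun I M) X (Y : Fin q → Sec I F A),
      η (Fin.cons (f • X) Y) = f • η (Fin.cons X Y) := fun f X Y =>
    isTensorial_update hη (Fin.cons X Y) 0 f _ (by simp) (fun i hi => by
      obtain ⟨t, rfl⟩ := Fin.exists_succ_eq.2 hi
      simp)
  have hηadd : ∀ X X' (Y : Fin q → Sec I F A),
      η (Fin.cons (X + X') Y) = η (Fin.cons X Y) + η (Fin.cons X' Y) := fun X X' Y =>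
    η.toMultilinearMap.cons_add Y X X'
  have hcons : ∀ σ : Perm (Fin (q + 1 + 1)),
      (Fin.cons (Z (σ 1)) fun j : Fin q => Z (σ j.succ.succ)) =
        fun j : Fin (q + 1) => Z (σ j.succ) := by
    intro σ
    funext j
    refine Fin.cases ?_ (fun j => ?_) j <;> simp
  have hleft : ∀ (f : SmoothFun I M) X Y, L.bracket (f • X) Y =
      f • L.bracket X Y + -(L.anchor.deriv Y f • X) := by
    intro f X Y
    rw [L.bracket_skew, L.leibniz, neg_add, ← smul_fun_neg, ← L.bracket_skew]
  have h0 : (2 * q.factorial) • bracketSum L η Z' =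
      (2 * q.factorial) • (f • bracketSum L η Z) +
      ∑ σ : Perm (Fin (q + 1 + 1)), ((if σ 1 = i then corr L η Z f σ else 0) +
        (if (σ * Equiv.swap 0 1 : Perm (Fin (q + 1 + 1))) 1 = i then corr L η Z f (σ * Equiv.swap 0 1) else 0)) := by
    have h1 : (2 * q.factorial) • (f • bracketSum L η Z) =
        f • ((2 * q.factorial) • bracketSum L η Z) := by
      rw [← Nat.cast_smul_eq_nsmul ℝ, ← Nat.cast_smul_eq_nsmul ℝ, smul_fun_const]
    rw [h1, factorial_smul_bracketSum, factorial_smul_bracketSum, smul_fun_sum,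
      ← Finset.sum_add_distrib]
    refine Finset.sum_congr rfl fun σ _ => ?_
    have h01 : (0 : Fin (q + 1 + 1)) ≠ 1 := by simp
    have hsw : corr L η Z f (σ * Equiv.swap 0 1) = -(Equiv.Perm.sign σ •
        (L.anchor.deriv (Z (σ 1)) f •
          η (Fin.cons (Z (σ 0)) fun j : Fin q => Z (σ j.succ.succ)))) := by
      have : (fun j : Fin (q + 1) => Z ((σ * Equiv.swap 0 1 : Perm (Fin (q + 1 + 1))) j.succ)) =
          Fin.cons (Z (σ 0)) fun j : Fin q => Z (σ j.succ.succ) := by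
        funext j
        refine Fin.cases ?_ (fun j => ?_) j
        · simp
        · have : Equiv.swap (0 : Fin (q + 1 + 1)) 1 j.succ.succ = j.succ.succ :=
            Equiv.swap_apply_of_ne_of_ne (Fin.succ_ne_zero _) (fun h =>
              Fin.succ_ne_zero j (Fin.succ_injective _ h))
          simp [this]
      rw [corr, this, Equiv.Perm.sign_mul, Equiv.Perm.sign_swap h01]
      simp
    have hm : (σ * Equiv.swap 0 1 : Perm (Fin (q + 1 + 1))) 1 = σ 0 := by simp
    rw [hsw, hm]
    by_cases hi0 : σ 0 = i
    · have hi1 : σ 1 ≠ i := fun h => h01 (σ.injective (hi0.trans h.symm))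
      have hrest : (fun j : Fin q => Z' (σ j.succ.succ)) = fun j => Z (σ j.succ.succ) := by
        funext j
        apply hother
        rw [← hi0]
        exact fun h' => Fin.succ_ne_zero _ (σ.injective h')
      rw [if_neg hi1, if_pos hi0, hrest, hother _ hi1, hi0, hself, ← hi0, hleft, hηadd,
        ← smul_fun_neg, hη0, hη0, smul_add, zero_add, smul_fun_units]
      congr 1
      have hneg : η (Fin.cons (-Z (σ 0)) fun j : Fin q => Z (σ j.succ.succ)) =
          -η (Fin.cons (Z (σ 0)) fun j : Fin q => Z (σ j.succ.succ)) := by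
        have := η.toMultilinearMap.cons_smul (fun j : Fin q => Z (σ j.succ.succ)) (-1) (Z (σ 0))
        simpa using! this
      rw [hneg, smul_fun_neg, smul_neg]
    · by_cases hi1 : σ 1 = i
      · have hrest : (fun j : Fin q => Z' (σ j.succ.succ)) = fun j => Z (σ j.succ.succ) := by
          funext j
          apply hother
          rw [← hi1]
          exact fun h' => Fin.succ_ne_zero j (Fin.succ_injective _ (σ.injective h'))
        rw [if_pos hi1, if_neg hi0, hrest, hother _ hi0, hi1, hself, ← hi1, L.leibniz, hηadd,
          hη0, hη0, smul_add, add_zero, smul_fun_units, hcons]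
        rfl
      · rw [if_neg hi0, if_neg hi1, hother _ hi0, hother _ hi1, add_zero, add_zero]
        have hne : σ.symm i ≠ 0 := fun h' => hi0 (by rw [← h']; simp)
        obtain ⟨t, ht⟩ := Fin.exists_succ_eq.2 hne
        have hne' : t ≠ 0 := by
          rintro rfl
          apply hi1
          have : (1 : Fin (q + 1 + 1)) = (0 : Fin (q + 1)).succ := rfl
          rw [this, ht]; simp
        obtain ⟨u, hu⟩ := Fin.exists_succ_eq.2 hne'
        have hu' : σ u.succ.succ = i := by rw [hu, ht]; simp
        rw [isTensorial_update hη
          (Fin.cons (L.bracket (Z (σ 0)) (Z (σ 1))) fun j : Fin q => Z (σ j.succ.succ))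
          u.succ f _ (by simp only [Fin.cons_succ, hu', hself]) (fun j hj => by
            induction j using Fin.cases with
            | zero => simp
            | succ j =>
              simp only [Fin.cons_succ]
              apply hother
              rw [← hu']
              intro h'
              apply hj
              have := Fin.succ_injective _ (σ.injective h')
              rw [this])]
        rw [smul_fun_units]
  have h2 : ∑ σ : Perm (Fin (q + 1 + 1)),
      (if (σ * Equiv.swap 0 1 : Perm (Fin (q + 1 + 1))) 1 = i then corr L η Z f (σ * Equiv.swap 0 1) else 0) =
      ∑ σ : Perm (Fin (q + 1 + 1)), (if σ 1 = i then corr L η Z f σ else 0) :=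
    Fintype.sum_equiv (Equiv.mulRight (Equiv.swap 0 1)) _ _ fun σ => rfl
  rw [Finset.sum_add_distrib, h2, ← two_smul ℕ, mul_smul, mul_smul, ← smul_add] at h0
  rw [← Nat.cast_smul_eq_nsmul ℝ 2, ← Nat.cast_smul_eq_nsmul ℝ 2] at h0
  exact smul_right_injective _ (by norm_num : ((2 : ℕ) : ℝ) ≠ 0) h0

theorem isTensorial_covSum_sub_bracketSum (nab : AConnection F' E L) {k : ℕ}
    {η : Sec I F A [⋀^Fin k]→ₗ[ℝ] Sec I F' E} (hη : IsTensorial η) :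
    IsTensorial (covSum nab η - bracketSum L η) := by
  intro Z i f
  rw [AlternatingMap.sub_apply, AlternatingMap.sub_apply]
  have hsub : ∀ s t : Sec I F' E, f • (s - t) = f • s - f • t := fun s t => by
    rw [sub_eq_add_neg, smul_fun_add, smul_fun_neg, ← sub_eq_add_neg]
  rw [hsub]
  cases k with
  | zero =>
    have h : ∀ Y : Fin (0 + 1) → Sec I F A, covSum nab η Y = nab.cov (Y 0) (η ![]) := by
      intro Y
      have h1 := factorial_smul_covSum nab η Y
      rw [Nat.factorial_zero, one_smul] at h1
      rw [h1]
      have hu : (Finset.univ : Finset (Perm (Fin (0 + 1)))) = {1} := by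
        ext σ
        simp only [Finset.mem_univ, Finset.mem_singleton, true_iff]
        exact Subsingleton.elim (α := Perm (Fin 1)) _ _
      rw [hu, Finset.sum_singleton, Equiv.Perm.sign_one, one_smul]
      congr 2
      exact Subsingleton.elim _ _
    obtain rfl : i = 0 := Subsingleton.elim (α := Fin 1) _ _
    simp only [bracketSum, AlternatingMap.zero_apply, h, Function.update_self, nab.cov_smul]
    congr 1
    ext x
    exact (smul_zero _).symm
  | succ q =>
    have h1 := covSum_smul nab hη Z i f
    have h2 := bracketSum_smul (L := L) hη Z i f
    have h3 : q.factorial • (covSum nab η (Function.update Z i (f • Z i)) -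
        bracketSum L η (Function.update Z i (f • Z i))) =
        q.factorial • (f • covSum nab η Z - f • bracketSum L η Z) := by
      rw [smul_sub, smul_sub, h1, h2]
      abel
    rw [← Nat.cast_smul_eq_nsmul ℝ, ← Nat.cast_smul_eq_nsmul ℝ] at h3
    exact smul_right_injective _
      (Nat.cast_ne_zero.2 q.factorial_ne_zero : ((q.factorial : ℕ) : ℝ) ≠ 0) h3

section Tensorial

variable [FiniteDimensional ℝ EM] [T2Space M] [FiniteDimensional ℝ F]
  [ContMDiffVectorBundle ∞ F A I]

/-- A tensorial map on sections is pointwise. -/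
theorem IsTensorial.congr {k : ℕ} {T : Sec I F A [⋀^Fin k]→ₗ[ℝ] Sec I F' E} (hT : IsTensorial T)
    (x : M) (Z Z' : Fin k → Sec I F A) (h : ∀ i, Z i x = Z' i x) : T Z x = T Z' x := by
  classical
  have step : ∀ (Z : Fin k → Sec I F A) (i : Fin k) (W : Sec I F A), Z i x = W x →
      T Z x = T (Function.update Z i W) x := by
    intro Z i W hW
    let S : Sec I F A →ₗ[ℝ] E x :=
      (evalAt (I := I) (F := F') (A := E) x).comp (T.toMultilinearMap.toLinearMap Z i)
    have hS : ∀ Y, S Y = T (Function.update Z i Y) x := fun Y => rfl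
    have h0 := eq_zero_of_tensorial x S (fun f s => by
      have := hT (Function.update Z i s) i f
      rw [Function.update_self, Function.update_idem] at this
      rw [hS, hS, this]
      rfl) (Z i - W) (by
        change Z i x - W x = 0
        rw [hW, sub_self])
    rw [map_sub, sub_eq_zero, hS, hS, Function.update_eq_self] at h0
    exact h0
  have main : ∀ s : Finset (Fin k), T Z x = T (s.piecewise Z' Z) x := by
    intro s
    induction s using Finset.induction_on with
    | empty => simp
    | insert i s hi ih =>
      rw [ih, Finset.piecewise_insert]
      apply step
      rw [Finset.piecewise_eq_of_notMem _ _ _ hi, h]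
  rw [main Finset.univ, Finset.piecewise_univ]

/-- The form with prescribed tensorial values on sections. -/
def formOfTensorial {k : ℕ} (T : Sec I F A [⋀^Fin k]→ₗ[ℝ] Sec I F' E) (hT : IsTensorial T) :
    Forms I F A F' E k :=
  ⟨fun x => (evalAt (I := I) (F := F') (A := E) x).compAlternatingMap
    (T.compLinearMap (sectionThrough (I := I) (F := F) (A := A) x)), by
    intro Z
    have h : ∀ x, ((evalAt (I := I) (F := F') (A := E) x).compAlternatingMap
        (T.compLinearMap (sectionThrough (I := I) (F := F) (A := A) x))) (fun i => Z i x) =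
        T Z x := fun x => hT.congr x _ _ fun i => sectionThrough_apply x (Z i x)
    simp only [h]
    exact (T Z).contMDiff⟩

theorem onSections_formOfTensorial {k : ℕ} (T : Sec I F A [⋀^Fin k]→ₗ[ℝ] Sec I F' E)
    (hT : IsTensorial T) : onSections (formOfTensorial T hT) = T := by
  ext Z x
  exact hT.congr x _ _ fun i => sectionThrough_apply x (Z i x)

/-- A form is determined by its values on sections. -/
theorem forms_ext {k : ℕ} {η θ : Forms I F A F' E k}
    (h : onSections η = onSections θ) : η = θ := by
  apply Subtype.ext
  funext x
  ext v
  have := congrArg (fun s : Sec I F' E => s x) (DFunLike.congr_fun h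
    fun i => sectionThrough (I := I) (F := F) (A := A) x (v i))
  simpa only [onSections_apply, sectionThrough_apply] using this



/-- The covariant exterior derivative `d^∇ : Ω^k(A, E) → Ω^{k+1}(A, E)`. -/
def extDeriv (nab : AConnection F' E L) (k : ℕ) :
    Forms I F A F' E k →ₗ[ℝ] Forms I F A F' E (k + 1) where
  toFun η := formOfTensorial (covSum nab (onSections η) - bracketSum L (onSections η))
    (isTensorial_covSum_sub_bracketSum nab (onSections_isTensorial η))
  map_add' η θ := by
    apply forms_ext
    have hadd : ∀ {m : ℕ} (η θ : Forms I F A F' E m),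
        onSections (η + θ) = onSections η + onSections θ := fun η θ => rfl
    rw [hadd (formOfTensorial _ _)]
    simp only [onSections_formOfTensorial, hadd]
    ext1 Z
    simp only [AlternatingMap.sub_apply, AlternatingMap.add_apply]
    cases k with
    | zero =>
      simp only [bracketSum, covSum_apply, AlternatingMap.add_apply, map_add, smul_add,
        Finset.sum_add_distrib]
      simp
    | succ q =>
      simp only [bracketSum_apply, covSum_apply, AlternatingMap.add_apply, map_add, smul_add,
        Finset.sum_add_distrib]
      abel
  map_smul' c η := by
    apply forms_ext
    have hsmul : ∀ {m : ℕ} (η : Forms I F A F' E m),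
        onSections (c • η) = c • onSections η := fun η => rfl
    rw [RingHom.id_apply, hsmul (formOfTensorial _ _)]
    simp only [onSections_formOfTensorial, hsmul]
    ext1 Z
    simp only [AlternatingMap.sub_apply, AlternatingMap.smul_apply]
    cases k with
    | zero =>
      simp only [bracketSum, covSum_apply, AlternatingMap.smul_apply, map_smul, smul_sub,
        Finset.smul_sum]
      simp [smul_comm _ c]
    | succ q =>
      simp only [bracketSum_apply, covSum_apply, AlternatingMap.smul_apply, map_smul, smul_sub,
        Finset.smul_sum]
      simp [smul_comm _ c]

/-- The defining formula of `d^∇`, on sections of `A`. -/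
theorem onSections_extDeriv (nab : AConnection F' E L) {k : ℕ} (η : Forms I F A F' E k) :
    onSections (extDeriv nab k η) = covSum nab (onSections η) - bracketSum L (onSections η) :=
  onSections_formOfTensorial _
    (isTensorial_covSum_sub_bracketSum nab (onSections_isTensorial η))

end Tensorial

/-- The form `i_φ ψ ∈ Ω^{p+k}(A, E)` for `φ ∈ Ω^p(A, A)` and `ψ ∈ Ω^{k+1}(A, E)`:
`(i_φ ψ)(Z₁, …, Z_{p+k}) =
  ∑_{σ ∈ Sh_{p,k}} (-1)^σ ψ(φ(Z_{σ(1)}, …, Z_{σ(p)}), Z_{σ(p+1)}, …, Z_{σ(p+k)})`. -/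
def insertForm {p k : ℕ} (φ : Forms I F A F A p) (ψ : Forms I F A F' E (k + 1)) :
    Forms I F A F' E (p + k) :=
  ⟨fun x => shuffleSum rfl (φ.1 x) (ψ.1 x).curryLeft, by
    intro Z
    have h : ∀ x, shuffleSum rfl (φ.1 x) (ψ.1 x).curryLeft (fun i => Z i x) =
        shuffleSum rfl (onSections φ) (onSections ψ).curryLeft Z x := by
      intro x
      rw [shuffleSum_apply, shuffleSum_apply]
      change _ = evalAt (I := I) (F := F') (A := E) x _
      rw [map_sum]
      refine Finset.sum_congr rfl fun σ _ => ?_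
      have hu : ∀ (u : ℤˣ) (s : Sec I F' E), evalAt x (u • s) = u • evalAt x s := by
        intro u s
        rcases Int.units_eq_one_or u with hu | hu <;> simp [hu]
      rw [hu]
      congr 1
      change ψ.1 x _ = ψ.1 x _
      congr 1
      funext j
      refine Fin.cases ?_ (fun j => ?_) j <;> rfl
    simp only [h]
    exact (shuffleSum rfl (onSections φ) (onSections ψ).curryLeft Z).contMDiff⟩

theorem insertForm_apply {p k : ℕ} (φ : Forms I F A F A p) (ψ : Forms I F A F' E (k + 1))
    (x : M) (v : Fin (p + k) → A x) :
    (insertForm φ ψ).1 x v = ∑ σ ∈ shuffles p k rfl, Equiv.Perm.sign σ •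
      ψ.1 x (Fin.cons (φ.1 x fun i => v (σ (fstIdx rfl i))) fun j => v (σ (sndIdx rfl j))) := rfl

/-- `(φ, ψ) ↦ i_φ ψ` as a bilinear map. -/
def insertLin (p k : ℕ) :
    Forms I F A F A p →ₗ[ℝ] Forms I F A F' E (k + 1) →ₗ[ℝ] Forms I F A F' E (p + k) :=
  LinearMap.mk₂ ℝ insertForm
    (fun φ φ' ψ => by
      apply Subtype.ext; funext x; ext v
      change (insertForm (φ + φ') ψ).1 x v = (insertForm φ ψ).1 x v + (insertForm φ' ψ).1 x v
      rw [insertForm_apply, insertForm_apply, insertForm_apply, ← Finset.sum_add_distrib]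
      refine Finset.sum_congr rfl fun σ _ => ?_
      rw [← smul_add]
      congr 1
      exact (ψ.1 x).toMultilinearMap.cons_add _ _ _)
    (fun c φ ψ => by
      apply Subtype.ext; funext x; ext v
      change (insertForm (c • φ) ψ).1 x v = c • (insertForm φ ψ).1 x v
      rw [insertForm_apply, insertForm_apply, Finset.smul_sum]
      refine Finset.sum_congr rfl fun σ _ => ?_
      rw [smul_comm c]
      congr 1
      exact (ψ.1 x).toMultilinearMap.cons_smul _ _ _)
    (fun φ ψ ψ' => by
      apply Subtype.ext; funext x; ext v
      change (insertForm φ (ψ + ψ')).1 x v = (insertForm φ ψ).1 x v + (insertForm φ ψ').1 x v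
      rw [insertForm_apply, insertForm_apply, insertForm_apply, ← Finset.sum_add_distrib]
      refine Finset.sum_congr rfl fun σ _ => ?_
      rw [← smul_add]
      rfl)
    (fun c φ ψ => by
      apply Subtype.ext; funext x; ext v
      change (insertForm φ (c • ψ)).1 x v = c • (insertForm φ ψ).1 x v
      rw [insertForm_apply, insertForm_apply, Finset.smul_sum]
      refine Finset.sum_congr rfl fun σ _ => ?_
      rw [smul_comm c]
      rfl)

/-- The operator `i_φ` on `Ω^*(A, E)` for homogeneous `φ ∈ Ω^p(A, A)`; it vanishes on
`Ω^0(A, E)`. -/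
def insertHom (p : ℕ) :
    Forms I F A F A p →ₗ[ℝ] Module.End ℝ (AllForms I F A F' E) where
  toFun φ := liftForms fun m => match m with
    | 0 => 0
    | k + 1 => (ofForm (p + k)).comp (insertLin p k φ)
  map_add' φ φ' := by
    apply allForms_hom_ext
    rintro (_ | k) ψ <;> simp [liftForms_ofForm]
  map_smul' c φ := by
    apply allForms_hom_ext
    rintro (_ | k) ψ <;> simp [liftForms_ofForm]

/-- The operator `i_φ` on `Ω^*(A, E)`, extended linearly to all `φ ∈ Ω^*(A, A)`. -/
def insertOp : AllForms I F A F A →ₗ[ℝ] Module.End ℝ (AllForms I F A F' E) :=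
  liftForms fun p => insertHom p

/-- The graded commutator `[P, Q] = P Q - (-1)^{ab} Q P` of operators `P` of degree `a` and `Q` of
degree `b`. -/
def gradedComm {Ω : Type*} [AddCommGroup Ω] [Module ℝ Ω] (a b : ℤ) (P Q : Module.End ℝ Ω) :
    Module.End ℝ Ω :=
  P * Q - (-1 : ℝ) ^ (a * b) • (Q * P)

section Operators

variable [FiniteDimensional ℝ EM] [T2Space M] [FiniteDimensional ℝ F]
  [ContMDiffVectorBundle ∞ F A I]

/-- The operator `d^∇` on `Ω^*(A, E)`. -/
def extDerivOp (nab : AConnection F' E L) : Module.End ℝ (AllForms I F A F' E) :=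
  liftForms fun k => (ofForm (k + 1)).comp (extDeriv nab k)

/-- The covariant Lie derivative `ℒ^∇_φ = [i_φ, d^∇]` for `φ ∈ Ω^p(A, A)`. -/
def covLie (nab : AConnection F' E L) (p : ℕ) (φ : Forms I F A F A p) :
    Module.End ℝ (AllForms I F A F' E) :=
  gradedComm ((p : ℤ) - 1) 1 (insertHom p φ) (extDerivOp nab)

/-- The operator `∇_φ = ℒ^∇_φ - (-1)^p i_{d^∇ φ}` on `Ω^*(A, E)` for `φ ∈ Ω^p(A, A)`, where `ℒ^∇` is
formed with the connection `nabE` on `E` and `d^∇ φ` with the connection `nabA` on `A`. -/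
def nablaHom (nabA : AConnection F A L) (nabE : AConnection F' E L) (p : ℕ) :
    Forms I F A F A p →ₗ[ℝ] Module.End ℝ (AllForms I F A F' E) where
  toFun φ := covLie nabE p φ - (-1 : ℝ) ^ p • insertHom (p + 1) (extDeriv nabA p φ)
  map_add' φ φ' := by
    simp only [covLie, gradedComm, map_add, add_mul, mul_add, smul_add]
    abel
  map_smul' c φ := by
    simp only [covLie, gradedComm, map_smul, smul_mul_assoc, mul_smul_comm, smul_sub,
      RingHom.id_apply, smul_comm _ c]

/-- The operator `∇_φ` on `Ω^*(A, E)`, extended linearly to all `φ ∈ Ω^*(A, A)`. -/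
def nablaOp (nabA : AConnection F A L) (nabE : AConnection F' E L) :
    AllForms I F A F A →ₗ[ℝ] Module.End ℝ (AllForms I F A F' E) :=
  liftForms fun p => nablaHom nabA nabE p

end Operators

end Algebroids

end LieAlgebroidForms

/-!
The identity only involves the values of forms on sections, and on sections nothing but linear
algebra over `ℝ` is needed: `V = Γ(A)` and `W = Γ(E)` are real vector spaces with bilinear maps
`∇ : V × V → V` and `∇ : V × W → W`, and the bracket of `V` is the commutator `∇_X Y - ∇_Y X`.

A form of any degree is encoded as a function on lists of sections (`ListForm`). On such functions
the signed shuffle product `shuf` is defined by recursion on the list of arguments, so that its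
graded properties are proved by induction on lists, without casts between degrees: it is
associative (`shuf_assoc`) and graded commutative (`shuf_left_comm`), and derivations induced by
`∇_X` satisfy the Leibniz rule (`der_shuf`).

The operator `i_φ` is the shuffle product of `φ` with `s`, the value of `φ` being fed into the first
argument of `s` (`insertion`). The point is that `∇_φ` has a similar description: it is the shuffle
product of `φ` with `∇s`, the value of `φ` being fed in as the direction of differentiation
(`covAlong`). With this description, the Leibniz rule writes `∇_φ i_ψ s` as `i_{∇_φ ψ} s` plus a
term in which both `φ` and `ψ` are inserted into `∇s`; likewise `i_ψ ∇_φ s` is `∇_{i_ψ φ} s` plus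
the same term up to sign, according to whether the value of `ψ` goes into `φ` or into `∇s`. This is
the commutator formula (`covAlong_insertion_comm`).

The same formula also justifies the description of `∇_φ`. As `∇` is torsion-free, `d^∇` is `∇_φ` for
`φ` the identity of `A`, a form of degree one (`covAlong_id`); and for this form in the place of `φ`
the commutator formula reads `∇_ψ = [i_ψ, d^∇] - (-1)^p i_{d^∇ ψ}`, which is how `∇_ψ` is defined
(`toListForm_nablaOp`). What remains is that the sums over shuffles in the definitions of `i_φ` and
`d^∇` are signed shuffle products (`ofAlt_shuffleSum`).
-/

set_option linter.unusedSectionVars false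

/-! ### Signed shuffle products on functions of lists -/

namespace ListForms

variable {V : Type*} {P Q R S T : Type*} [AddCommGroup P] [Module ℝ P] [AddCommGroup Q] [Module ℝ Q]
  [AddCommGroup R] [Module ℝ R] [AddCommGroup S] [Module ℝ S] [AddCommGroup T] [Module ℝ T]

/-- The contraction `f ↦ f(x, …)` in the first argument. -/
def contr (x : V) : (List V → P) →ₗ[ℝ] (List V → P) where
  toFun f := fun l => f (x :: l)
  map_add' _ _ := rfl
  map_smul' _ _ := rfl

theorem contr_apply (x : V) (f : List V → P) (l : List V) : contr x f l = f (x :: l) := rfl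

/-- The grading involution, which is `(-1)^k` on `k`-forms. -/
def gradeInv : (List V → P) →ₗ[ℝ] (List V → P) where
  toFun f := fun l => (-1 : ℝ) ^ l.length • f l
  map_add' _ _ := by funext l; simp
  map_smul' c f := by funext l; simp [smul_comm c]

theorem gradeInv_apply (f : List V → P) (l : List V) :
    gradeInv f l = (-1 : ℝ) ^ l.length • f l := rfl

theorem contr_gradeInv (x : V) (f : List V → P) :
    contr x (gradeInv f) = -gradeInv (contr x f) := by
  funext l
  simp [contr_apply, gradeInv_apply, pow_succ]

/-- The signed shuffle product, as a function of its factors. Its value on `Z₁, …, Z_n` is the sum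
of `± B(f(Z_{i₁}, …, Z_{i_p}), g(Z_{j₁}, …, Z_{j_q}))` over all ways to split the arguments into two
increasing sequences. The recursion decides which factor receives the first argument: passing it to
`g` moves it past all arguments of `f`. -/
def shufAux (B : P →ₗ[ℝ] Q →ₗ[ℝ] R) : (List V → P) → (List V → Q) → List V → R
  | f, g, [] => B (f []) (g [])
  | f, g, x :: l => shufAux B (contr x f) g l + shufAux B (gradeInv f) (contr x g) l

/-- The signed shuffle product as a bilinear map. -/
def shuf (B : P →ₗ[ℝ] Q →ₗ[ℝ] R) : (List V → P) →ₗ[ℝ] (List V → Q) →ₗ[ℝ] (List V → R) :=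
  LinearMap.mk₂ ℝ (shufAux B)
    (fun f f' g => by
      funext l
      induction l generalizing f f' g with
      | nil => simp [shufAux]
      | cons x l ih => simp only [shufAux, map_add, ih, Pi.add_apply]; abel)
    (fun c f g => by
      funext l
      induction l generalizing f g with
      | nil => simp [shufAux]
      | cons x l ih => simp only [shufAux, map_smul, ih, Pi.smul_apply, smul_add])
    (fun f g g' => by
      funext l
      induction l generalizing f g g' with
      | nil => simp [shufAux]
      | cons x l ih => simp only [shufAux, map_add, ih, Pi.add_apply]; abel)
    (fun c f g => by
      funext l
      induction l generalizing f g with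
      | nil => simp [shufAux]
      | cons x l ih => simp only [shufAux, map_smul, ih, Pi.smul_apply, smul_add])

theorem shuf_nil (B : P →ₗ[ℝ] Q →ₗ[ℝ] R) (f : List V → P) (g : List V → Q) :
    shuf B f g [] = B (f []) (g []) := rfl

theorem shuf_cons (B : P →ₗ[ℝ] Q →ₗ[ℝ] R) (f : List V → P) (g : List V → Q) (x : V)
    (l : List V) :
    shuf B f g (x :: l) = shuf B (contr x f) g l + shuf B (gradeInv f) (contr x g) l := rfl

theorem contr_shuf (B : P →ₗ[ℝ] Q →ₗ[ℝ] R) (f : List V → P) (g : List V → Q) (x : V) :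
    contr x (shuf B f g) = shuf B (contr x f) g + shuf B (gradeInv f) (contr x g) := rfl

theorem gradeInv_shuf (B : P →ₗ[ℝ] Q →ₗ[ℝ] R) (f : List V → P) (g : List V → Q) :
    gradeInv (shuf B f g) = shuf B (gradeInv f) (gradeInv g) := by
  funext l
  induction l generalizing f g with
  | nil => simp [gradeInv_apply, shuf_nil]
  | cons x l ih =>
    have h1 := ih (contr x f) g
    have h2 := ih (gradeInv f) (contr x g)
    simp only [gradeInv_apply] at h1 h2
    simp only [gradeInv_apply, shuf_cons, contr_gradeInv, map_neg, LinearMap.neg_apply,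
      Pi.neg_apply, List.length_cons, pow_succ, mul_neg_one, neg_smul, smul_add, h1, h2]

/-- Naturality of the signed shuffle product in all three spaces of values. -/
theorem shuf_natural {P' Q' R' : Type*} [AddCommGroup P'] [Module ℝ P'] [AddCommGroup Q']
    [Module ℝ Q'] [AddCommGroup R'] [Module ℝ R'] {B : P →ₗ[ℝ] Q →ₗ[ℝ] R}
    {B' : P' →ₗ[ℝ] Q' →ₗ[ℝ] R'} (a : P →ₗ[ℝ] P') (b : Q →ₗ[ℝ] Q') (c : R →ₗ[ℝ] R')
    (h : ∀ p q, c (B p q) = B' (a p) (b q)) (f : List V → P) (g : List V → Q) (l : List V) :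
    c (shuf B f g l) = shuf B' (fun l => a (f l)) (fun l => b (g l)) l := by
  induction l generalizing f g with
  | nil => exact h _ _
  | cons x l ih =>
    rw [shuf_cons, shuf_cons, map_add, ih, ih]
    have ha : (fun l => a (gradeInv f l)) = gradeInv fun l => a (f l) :=
      funext fun l => map_smul a _ _
    rw [ha]
    rfl

theorem shuf_assoc {B : R →ₗ[ℝ] S →ₗ[ℝ] T} {C : P →ₗ[ℝ] Q →ₗ[ℝ] R}
    {U : Type*} [AddCommGroup U] [Module ℝ U]
    {B' : P →ₗ[ℝ] U →ₗ[ℝ] T} {C' : Q →ₗ[ℝ] S →ₗ[ℝ] U}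
    (hB : ∀ p q s, B (C p q) s = B' p (C' q s))
    (f : List V → P) (g : List V → Q) (h : List V → S) :
    shuf B (shuf C f g) h = shuf B' f (shuf C' g h) := by
  funext l
  induction l generalizing f g h with
  | nil => exact hB _ _ _
  | cons x l ih =>
    rw [shuf_cons, shuf_cons, contr_shuf, contr_shuf, gradeInv_shuf, map_add, map_add,
      LinearMap.add_apply, Pi.add_apply, Pi.add_apply, ih, ih, ih, add_assoc]

/-- `f` is supported in degrees of the parity of `a`. -/
def HasParity (a : ℕ) (f : List V → P) : Prop := gradeInv f = (-1 : ℝ) ^ a • f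

theorem HasParity.contr {a : ℕ} {f : List V → P} (h : HasParity a f) (x : V) :
    HasParity (a + 1) (contr x f) := by
  have h1 := contr_gradeInv x f
  rw [h, map_smul] at h1
  rw [HasParity, pow_succ, mul_neg_one, neg_smul, h1, neg_neg]

/-- Graded commutativity of the signed shuffle product, in the presence of a third factor. -/
theorem shuf_left_comm {U U' : Type*} [AddCommGroup U] [Module ℝ U] [AddCommGroup U']
    [Module ℝ U'] {B : P →ₗ[ℝ] U →ₗ[ℝ] T} {C : Q →ₗ[ℝ] S →ₗ[ℝ] U}
    {B' : Q →ₗ[ℝ] U' →ₗ[ℝ] T} {C' : P →ₗ[ℝ] S →ₗ[ℝ] U'}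
    (hB : ∀ p q s, B p (C q s) = B' q (C' p s)) {a b : ℕ}
    {f : List V → P} {g : List V → Q} (hf : HasParity a f) (hg : HasParity b g)
    (h : List V → S) :
    shuf B f (shuf C g h) = (-1 : ℝ) ^ (a * b) • shuf B' g (shuf C' f h) := by
  funext l
  induction l generalizing f g h a b with
  | nil =>
    rcases Nat.even_or_odd (a * b) with hab | hab
    · simp [shuf_nil, hab.neg_one_pow, hB]
    · -- `a` is odd, so `f` has no component of degree zero.
      have h0 : f [] = 0 := by
        have := congrFun hf []
        rw [(Nat.odd_mul.1 hab).1.neg_one_pow] at this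
        have h2 : f [] = -f [] := by simpa [gradeInv_apply] using this
        have h3 : (2 : ℝ) • f [] = 0 := by rw [two_smul]; exact eq_neg_iff_add_eq_zero.1 h2
        exact (smul_eq_zero.1 h3).resolve_left two_ne_zero
      simp [shuf_nil, h0]
  | cons x l ih =>
    have hf' : gradeInv f = (-1 : ℝ) ^ a • f := hf
    have hg' : gradeInv g = (-1 : ℝ) ^ b • g := hg
    simp only [Pi.smul_apply, shuf_cons, contr_shuf, hf', hg', map_add, map_smul,
      LinearMap.smul_apply, Pi.add_apply, ih (hf.contr x) hg, ih hf (hg.contr x), ih hf hg,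
      smul_smul, smul_add, ← pow_add]
    have e1 : (-1 : ℝ) ^ ((a + 1) * b) = (-1) ^ (a * b + b) := by congr 1; ring
    have e2 : (-1 : ℝ) ^ (a + a * (b + 1)) = (-1) ^ (a * b) := by
      rw [show a + a * (b + 1) = a * b + 2 * a by ring, pow_add, pow_mul]; simp
    have e3 : (-1 : ℝ) ^ (b + a + a * b) = (-1) ^ (a * b + (a + b)) := by congr 1; ring
    rw [e1, e2, e3]
    abel

end ListForms

/-! ### Multilinear forms, insertion and covariant differentiation -/

namespace ListForms

variable {V W P Q R : Type*} [AddCommGroup V] [Module ℝ V] [AddCommGroup W] [Module ℝ W]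
  [AddCommGroup P] [Module ℝ P] [AddCommGroup Q] [Module ℝ Q] [AddCommGroup R] [Module ℝ R]

variable (V W) in
/-- The product over all `k` of the spaces of `k`-linear maps `V × ⋯ × V → W`. An element is
encoded as a function on lists, so that degrees need not be tracked by types. -/
def ListForm : Submodule ℝ (List V → W) where
  carrier := {s | (∀ l₁ l₂ v w, s (l₁ ++ (v + w) :: l₂) = s (l₁ ++ v :: l₂) + s (l₁ ++ w :: l₂)) ∧
    ∀ l₁ l₂ (c : ℝ) v, s (l₁ ++ (c • v) :: l₂) = c • s (l₁ ++ v :: l₂)}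
  add_mem' {s t} hs ht := ⟨fun l₁ l₂ v w => by simp only [Pi.add_apply, hs.1, ht.1]; abel,
    fun l₁ l₂ c v => by simp only [Pi.add_apply, hs.2, ht.2, smul_add]⟩
  zero_mem' := ⟨fun _ _ _ _ => by simp, fun _ _ _ _ => by simp⟩
  smul_mem' c s hs := ⟨fun l₁ l₂ v w => by simp only [Pi.smul_apply, hs.1, smul_add],
    fun l₁ l₂ d v => by simp only [Pi.smul_apply, hs.2, smul_comm c d]⟩

theorem contr_mem {s : List V → W} (hs : s ∈ ListForm V W) (x : V) : contr x s ∈ ListForm V W :=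
  ⟨fun l₁ l₂ v w => hs.1 (x :: l₁) l₂ v w, fun l₁ l₂ c v => hs.2 (x :: l₁) l₂ c v⟩

theorem gradeInv_mem {s : List V → W} (hs : s ∈ ListForm V W) : gradeInv s ∈ ListForm V W :=
  ⟨fun l₁ l₂ v w => by simp [gradeInv_apply, hs.1],
    fun l₁ l₂ c v => by simp only [gradeInv_apply, hs.2, List.length_append, List.length_cons,
      smul_comm c]⟩

theorem contr_add {s : List V → W} (hs : s ∈ ListForm V W) (v w : V) :
    contr (v + w) s = contr v s + contr w s := funext fun l => hs.1 [] l v w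

theorem contr_smul {s : List V → W} (hs : s ∈ ListForm V W) (c : ℝ) (v : V) :
    contr (c • v) s = c • contr v s := funext fun l => hs.2 [] l c v

theorem shuf_mem (B : P →ₗ[ℝ] Q →ₗ[ℝ] R) {f : List V → P} {g : List V → Q}
    (hf : f ∈ ListForm V P) (hg : g ∈ ListForm V Q) : shuf B f g ∈ ListForm V R := by
  constructor
  · intro l₁ l₂ v w
    induction l₁ generalizing f g with
    | nil =>
      simp only [List.nil_append, shuf_cons, contr_add hf, contr_add hg, map_add,
        LinearMap.add_apply, Pi.add_apply]
      abel
    | cons x l₁ ih =>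
      simp only [List.cons_append, shuf_cons, ih (contr_mem hf x) hg,
        ih (gradeInv_mem hf) (contr_mem hg x)]
      abel
  · intro l₁ l₂ c v
    induction l₁ generalizing f g with
    | nil =>
      simp only [List.nil_append, shuf_cons, contr_smul hf, contr_smul hg, map_smul,
        LinearMap.smul_apply, Pi.smul_apply, smul_add]
    | cons x l₁ ih =>
      simp only [List.cons_append, shuf_cons, ih (contr_mem hf x) hg,
        ih (gradeInv_mem hf) (contr_mem hg x), smul_add]

/-- A form with its first argument turned into an argument of the value. -/
def curryHead : ListForm V W →ₗ[ℝ] ListForm V (V →ₗ[ℝ] W) where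
  toFun s := ⟨fun l =>
    { toFun := fun v => s.1 (v :: l)
      map_add' := fun v w => s.2.1 [] l v w
      map_smul' := fun c v => s.2.2 [] l c v },
    fun l₁ l₂ v w => LinearMap.ext fun u => s.2.1 (u :: l₁) l₂ v w,
    fun l₁ l₂ c v => LinearMap.ext fun u => s.2.2 (u :: l₁) l₂ c v⟩
  map_add' _ _ := rfl
  map_smul' _ _ := rfl

/-- The extension of endomorphisms `δ` of `V` and `δW` of `W` to a derivation on forms:
`Z ↦ δW (s(Z₁, …, Z_k)) - ∑ᵢ s(Z₁, …, δ Zᵢ, …, Z_k)`. -/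
def der (δ : V →ₗ[ℝ] V) (δW : W →ₗ[ℝ] W) : (List V → W) → List V → W
  | s, [] => δW (s [])
  | s, x :: l => der δ δW (contr x s) l - s (δ x :: l)

theorem der_add (δ : V →ₗ[ℝ] V) (δW : W →ₗ[ℝ] W) (s t : List V → W) :
    der δ δW (s + t) = der δ δW s + der δ δW t := by
  funext l
  induction l generalizing s t with
  | nil => simp [der]
  | cons x l ih => simp only [der, map_add, ih, Pi.add_apply]; abel

theorem der_smul (δ : V →ₗ[ℝ] V) (δW : W →ₗ[ℝ] W) (c : ℝ) (s : List V → W) :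
    der δ δW (c • s) = c • der δ δW s := by
  funext l
  induction l generalizing s with
  | nil => simp [der]
  | cons x l ih => simp only [der, map_smul, ih, Pi.smul_apply, smul_sub]

theorem contr_der (δ : V →ₗ[ℝ] V) (δW : W →ₗ[ℝ] W) (s : List V → W) (x : V) :
    contr x (der δ δW s) = der δ δW (contr x s) - contr (δ x) s := rfl

theorem gradeInv_der (δ : V →ₗ[ℝ] V) (δW : W →ₗ[ℝ] W) (s : List V → W) :
    gradeInv (der δ δW s) = der δ δW (gradeInv s) := by
  funext l
  induction l generalizing s with
  | nil => simp [gradeInv_apply, der]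
  | cons x l ih =>
    have h := ih (contr x s)
    rw [gradeInv_apply] at h
    rw [der, contr_gradeInv, ← neg_one_smul ℝ, der_smul, Pi.smul_apply, ← h]
    simp [gradeInv_apply, der, pow_succ, sub_eq_add_neg, add_comm]

theorem der_mem (δ : V →ₗ[ℝ] V) (δW : W →ₗ[ℝ] W) {s : List V → W} (hs : s ∈ ListForm V W) :
    der δ δW s ∈ ListForm V W := by
  constructor
  · intro l₁ l₂ v w
    induction l₁ generalizing s with
    | nil =>
      have h : ∀ v w, s ((v + w) :: l₂) = s (v :: l₂) + s (w :: l₂) := hs.1 [] l₂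
      simp only [List.nil_append, der, contr_add hs, der_add, Pi.add_apply, map_add, h]
      abel
    | cons x l₁ ih =>
      have h := hs.1 (δ x :: l₁) l₂ v w
      simp only [List.cons_append] at h
      simp only [List.cons_append, der, ih (contr_mem hs x), h]
      abel
  · intro l₁ l₂ c v
    induction l₁ generalizing s with
    | nil =>
      have h : ∀ v, s ((c • v) :: l₂) = c • s (v :: l₂) := hs.2 [] l₂ c
      simp only [List.nil_append, der, contr_smul hs, der_smul, Pi.smul_apply, map_smul, h,
        smul_sub]
    | cons x l₁ ih =>
      have h := hs.2 (δ x :: l₁) l₂ c v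
      simp only [List.cons_append] at h
      simp only [List.cons_append, der, ih (contr_mem hs x), h, smul_sub]

theorem der_add_op (δ δ' : V →ₗ[ℝ] V) (δW δW' : W →ₗ[ℝ] W) {s : List V → W}
    (hs : s ∈ ListForm V W) (l : List V) :
    der (δ + δ') (δW + δW') s l = der δ δW s l + der δ' δW' s l := by
  induction l generalizing s with
  | nil => simp [der]
  | cons x l ih =>
    have h : ∀ v w, s ((v + w) :: l) = s (v :: l) + s (w :: l) := hs.1 [] l
    simp only [der, ih (contr_mem hs x), LinearMap.add_apply, h]
    abel

theorem der_smul_op (c : ℝ) (δ : V →ₗ[ℝ] V) (δW : W →ₗ[ℝ] W) {s : List V → W}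
    (hs : s ∈ ListForm V W) (l : List V) :
    der (c • δ) (c • δW) s l = c • der δ δW s l := by
  induction l generalizing s with
  | nil => simp [der]
  | cons x l ih =>
    have h : ∀ v, s ((c • v) :: l) = c • s (v :: l) := hs.2 [] l c
    simp only [der, ih (contr_mem hs x), LinearMap.smul_apply, h, smul_sub]

/-- The Leibniz rule for signed shuffle products. -/
theorem der_shuf (δ : V →ₗ[ℝ] V) {δP : P →ₗ[ℝ] P} {δQ : Q →ₗ[ℝ] Q} {δR : R →ₗ[ℝ] R}
    {B : P →ₗ[ℝ] Q →ₗ[ℝ] R} (hB : ∀ p q, δR (B p q) = B (δP p) q + B p (δQ q))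
    (f : List V → P) (g : List V → Q) :
    der δ δR (shuf B f g) = shuf B (der δ δP f) g + shuf B f (der δ δQ g) := by
  funext l
  induction l generalizing f g with
  | nil => exact hB _ _
  | cons x l ih =>
    simp only [der, contr_shuf, der_add, ih, Pi.add_apply, shuf_cons, contr_der, gradeInv_der,
      map_sub, LinearMap.sub_apply, Pi.sub_apply]
    abel

/-- The endomorphism of `Hom(V, W)` induced by `δ` and `δW`. -/
def homDer (δ : V →ₗ[ℝ] V) (δW : W →ₗ[ℝ] W) : (V →ₗ[ℝ] W) →ₗ[ℝ] (V →ₗ[ℝ] W) where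
  toFun h := δW ∘ₗ h - h ∘ₗ δ
  map_add' h h' := by ext; simp; abel
  map_smul' c h := by ext; simp [smul_sub]

/-- Inserting a fixed `w` into the values of `h` commutes with the derivations, up to the term in
which `w` itself is differentiated. -/
theorem der_homDer_apply (δ : V →ₗ[ℝ] V) (δW : W →ₗ[ℝ] W) (h : List V → V →ₗ[ℝ] W)
    (l : List V) (w : V) :
    der δ (homDer δ δW) h l w = der δ δW (fun l => h l w) l - h l (δ w) := by
  induction l generalizing h with
  | nil => rfl
  | cons x l ih =>
    simp only [der, LinearMap.sub_apply, ih]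
    change der δ δW (contr x fun l => h l w) l - _ - _ = _
    simp only [contr_apply]
    abel

/-- The total covariant derivative `∇s`, with the direction of differentiation as an argument of
the value. -/
def covD (D : V →ₗ[ℝ] V →ₗ[ℝ] V) (DW : V →ₗ[ℝ] W →ₗ[ℝ] W) (s : ListForm V W) :
    ListForm V (V →ₗ[ℝ] W) :=
  ⟨fun l =>
    { toFun := fun v => der (D v) (DW v) s.1 l
      map_add' := fun v w => by rw [map_add, map_add, der_add_op _ _ _ _ s.2]
      map_smul' := fun c v => by rw [map_smul, map_smul, der_smul_op _ _ _ s.2]; rfl },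
    fun l₁ l₂ v w => LinearMap.ext fun u => (der_mem (D u) (DW u) s.2).1 l₁ l₂ v w,
    fun l₁ l₂ c v => LinearMap.ext fun u => (der_mem (D u) (DW u) s.2).2 l₁ l₂ c v⟩

theorem covD_add (D : V →ₗ[ℝ] V →ₗ[ℝ] V) (DW : V →ₗ[ℝ] W →ₗ[ℝ] W) (s t : ListForm V W) :
    covD D DW (s + t) = covD D DW s + covD D DW t :=
  Subtype.ext (funext fun l => LinearMap.ext fun v => congrFun (der_add (D v) (DW v) s.1 t.1) l)

theorem covD_smul (D : V →ₗ[ℝ] V →ₗ[ℝ] V) (DW : V →ₗ[ℝ] W →ₗ[ℝ] W) (c : ℝ) (s : ListForm V W) :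
    covD D DW (c • s) = c • covD D DW s :=
  Subtype.ext (funext fun l => LinearMap.ext fun v => congrFun (der_smul (D v) (DW v) c s.1) l)

/-- The insertion operator `i_φ`, bilinearly in `φ` and its argument. -/
def insertion : ListForm V V →ₗ[ℝ] ListForm V W →ₗ[ℝ] ListForm V W :=
  LinearMap.mk₂ ℝ
    (fun φ s => ⟨shuf LinearMap.applyₗ φ.1 (curryHead s).1, shuf_mem _ φ.2 (curryHead s).2⟩)
    (fun φ φ' s => Subtype.ext (LinearMap.map_add₂ (shuf _) φ.1 φ'.1 (curryHead s).1))
    (fun c φ s => Subtype.ext (LinearMap.map_smul₂ (shuf _) c φ.1 (curryHead s).1))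
    (fun φ s t => Subtype.ext (map_add (shuf _ φ.1) (curryHead s).1 (curryHead t).1))
    (fun c φ s => Subtype.ext (map_smul (shuf _ φ.1) c (curryHead s).1))

/-- The operator `∇_φ`, bilinearly in `φ` and its argument: the value of `φ` is inserted into `∇s`
as the direction of differentiation. -/
def covAlong (D : V →ₗ[ℝ] V →ₗ[ℝ] V) (DW : V →ₗ[ℝ] W →ₗ[ℝ] W) :
    ListForm V V →ₗ[ℝ] ListForm V W →ₗ[ℝ] ListForm V W :=
  LinearMap.mk₂ ℝ
    (fun φ s => ⟨shuf LinearMap.applyₗ φ.1 (covD D DW s).1, shuf_mem _ φ.2 (covD D DW s).2⟩)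
    (fun φ φ' s => Subtype.ext (LinearMap.map_add₂ (shuf _) φ.1 φ'.1 (covD D DW s).1))
    (fun c φ s => Subtype.ext (LinearMap.map_smul₂ (shuf _) c φ.1 (covD D DW s).1))
    (fun φ s t => Subtype.ext (by
      rw [covD_add]; exact map_add (shuf _ φ.1) (covD D DW s).1 (covD D DW t).1))
    (fun c φ s => Subtype.ext (by
      rw [covD_smul]; exact map_smul (shuf _ φ.1) c (covD D DW s).1))

/-- Precomposition, as a bilinear map. -/
def precomp : (V →ₗ[ℝ] V) →ₗ[ℝ] (V →ₗ[ℝ] W) →ₗ[ℝ] (V →ₗ[ℝ] W) :=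
  (LinearMap.llcomp ℝ V V W).flip

/-- Exchanging the two arguments of a bilinear map, as a linear map. -/
def flipLin : (V →ₗ[ℝ] V →ₗ[ℝ] W) →ₗ[ℝ] (V →ₗ[ℝ] V →ₗ[ℝ] W) :=
  (LinearMap.lflip : (V →ₗ[ℝ] V →ₗ[ℝ] W) ≃ₗ[ℝ] _).toLinearMap

/-- The Leibniz rule for `∇(i_ψ s)`: the direction goes either into `∇ψ` or into `∇s`. -/
theorem covD_insertion (D : V →ₗ[ℝ] V →ₗ[ℝ] V) (DW : V →ₗ[ℝ] W →ₗ[ℝ] W) (ψ : ListForm V V)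
    (s : ListForm V W) :
    (covD D DW (insertion ψ s)).1 = shuf precomp (covD D D ψ).1 (curryHead s).1 +
      shuf LinearMap.applyₗ ψ.1 (curryHead (covD D DW s)).1 := by
  funext l
  ext v
  have hB : ∀ p (q : V →ₗ[ℝ] W), DW v (LinearMap.applyₗ p q) =
      LinearMap.applyₗ (D v p) q + LinearMap.applyₗ p (homDer (D v) (DW v) q) := by
    intro p q
    simp [homDer]
  have h1 := congrFun (der_shuf (D v) hB ψ.1 (curryHead s).1) l
  have h2 := shuf_natural (LinearMap.applyₗ v) LinearMap.id (LinearMap.applyₗ v)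
    (B := precomp) (B' := LinearMap.applyₗ) (fun p (q : V →ₗ[ℝ] W) => rfl) (covD D D ψ).1
    (curryHead s).1 l
  let e : (V →ₗ[ℝ] V →ₗ[ℝ] W) →ₗ[ℝ] (V →ₗ[ℝ] W) := LinearMap.applyₗ v ∘ₗ flipLin
  have h3 := shuf_natural (LinearMap.id : V →ₗ[ℝ] V) e (LinearMap.applyₗ v) (B := LinearMap.applyₗ)
    (B' := LinearMap.applyₗ) (fun p q => rfl) ψ.1 (curryHead (covD D DW s)).1 l
  have h4 : (fun l => e ((curryHead (covD D DW s)).1 l)) =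
      der (D v) (homDer (D v) (DW v)) (curryHead s).1 := by
    funext l
    ext w
    exact (der_homDer_apply (D v) (DW v) (curryHead s).1 l w).symm
  rw [h4] at h3
  exact h1.trans (congrArg₂ (· + ·) h2.symm h3.symm)

/-- The first argument of `∇_φ s` goes either into `φ` or into `∇s`. In the second case it passes
the arguments of `φ`, hence the sign, and the direction of differentiation is no longer the outer
argument of the value, hence the flip. -/
theorem curryHead_covAlong (D : V →ₗ[ℝ] V →ₗ[ℝ] V) (DW : V →ₗ[ℝ] W →ₗ[ℝ] W) (φ : ListForm V V)
    (s : ListForm V W) :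
    (curryHead (covAlong D DW φ s)).1 = shuf precomp (curryHead φ).1 (covD D DW s).1 +
      shuf (LinearMap.applyₗ.compl₂ flipLin) (gradeInv φ.1) (curryHead (covD D DW s)).1 := by
  funext l
  ext v
  have h2 := shuf_natural (LinearMap.applyₗ v) LinearMap.id (LinearMap.applyₗ v)
    (B := precomp) (B' := LinearMap.applyₗ) (fun p (q : V →ₗ[ℝ] W) => rfl) (curryHead φ).1
    (covD D DW s).1 l
  have h3 := shuf_natural (LinearMap.id : V →ₗ[ℝ] V) (LinearMap.applyₗ v) (LinearMap.applyₗ v)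
    (B := LinearMap.applyₗ.compl₂ flipLin) (B' := LinearMap.applyₗ)
    (fun p (q : V →ₗ[ℝ] V →ₗ[ℝ] W) => rfl) (gradeInv φ.1)
    (curryHead (covD D DW s)).1 l
  exact congrArg₂ (· + ·) h2.symm h3.symm

/-- The commutator of `∇_φ` and `i_ψ`. The terms in which `φ` and `ψ` are both inserted into `∇s`
cancel by graded commutativity. -/
theorem covAlong_insertion_comm (D : V →ₗ[ℝ] V →ₗ[ℝ] V) (DW : V →ₗ[ℝ] W →ₗ[ℝ] W) {a b : ℕ}
    {φ ψ : ListForm V V} (hφ : HasParity a φ.1) (hψ : HasParity b ψ.1) (s : ListForm V W) :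
    covAlong D DW φ (insertion ψ s) - (-1 : ℝ) ^ (a * b + a) • insertion ψ (covAlong D DW φ s) =
      insertion (covAlong D D φ ψ) s -
        (-1 : ℝ) ^ (a * b + a) • covAlong D DW (insertion ψ φ) s := by
  apply Subtype.ext
  have hφ' : gradeInv φ.1 = (-1 : ℝ) ^ a • φ.1 := hφ
  have h1 := shuf_assoc (B := LinearMap.applyₗ) (C := LinearMap.applyₗ) (B' := LinearMap.applyₗ)
    (C' := precomp) (fun p q (r : V →ₗ[ℝ] W) => rfl) φ.1 (covD D D ψ).1 (curryHead s).1
  have h2 := shuf_assoc (B := LinearMap.applyₗ) (C := LinearMap.applyₗ) (B' := LinearMap.applyₗ)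
    (C' := precomp) (fun p q (r : V →ₗ[ℝ] W) => rfl) ψ.1 (curryHead φ).1 (covD D DW s).1
  have h3 := shuf_left_comm (B := LinearMap.applyₗ) (C := LinearMap.applyₗ)
    (B' := LinearMap.applyₗ) (C' := LinearMap.applyₗ.compl₂ flipLin)
    (fun p q (r : V →ₗ[ℝ] V →ₗ[ℝ] W) => rfl) hφ hψ (curryHead (covD D DW s)).1
  change shuf LinearMap.applyₗ φ.1 (covD D DW (insertion ψ s)).1 -
    (-1 : ℝ) ^ (a * b + a) • shuf LinearMap.applyₗ ψ.1 (curryHead (covAlong D DW φ s)).1 =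
    shuf LinearMap.applyₗ (shuf LinearMap.applyₗ φ.1 (covD D D ψ).1) (curryHead s).1 -
      (-1 : ℝ) ^ (a * b + a) •
        shuf LinearMap.applyₗ (shuf LinearMap.applyₗ ψ.1 (curryHead φ).1) (covD D DW s).1
  have e : (-1 : ℝ) ^ (a * b + a) * (-1) ^ a = (-1) ^ (a * b) := by
    rw [← pow_add, show a * b + a + a = a * b + 2 * a by ring, pow_add, pow_mul]; simp
  rw [covD_insertion, curryHead_covAlong, map_add, map_add, ← h1, ← h2, h3, hφ']
  simp only [map_smul, LinearMap.smul_apply, smul_add, smul_smul, e]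
  abel

end ListForms

/-! ### Forms of low degree and the covariant exterior derivative -/

namespace ListForms

variable {V W P Q R : Type*} [AddCommGroup V] [Module ℝ V] [AddCommGroup W] [Module ℝ W]
  [AddCommGroup P] [Module ℝ P] [AddCommGroup Q] [Module ℝ Q] [AddCommGroup R] [Module ℝ R]

/-- The form of degree zero with value `p`. -/
def const (p : P) : List V → P
  | [] => p
  | _ :: _ => 0

theorem contr_const (x : V) (p : P) : contr x (const p) = 0 := rfl

theorem gradeInv_const (p : P) : gradeInv (const p : List V → P) = const p := by
  funext l
  cases l <;> simp [gradeInv_apply, const]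

theorem shuf_const_left (B : P →ₗ[ℝ] Q →ₗ[ℝ] R) (p : P) (g : List V → Q) (l : List V) :
    shuf B (const p) g l = B p (g l) := by
  induction l generalizing g with
  | nil => rfl
  | cons x l ih => rw [shuf_cons, contr_const, gradeInv_const, ih]; simp [contr_apply]

theorem shuf_const_right (B : P →ₗ[ℝ] Q →ₗ[ℝ] R) (f : List V → P) (q : Q) (l : List V) :
    shuf B f (const q) l = B (f l) q := by
  induction l generalizing f with
  | nil => rfl
  | cons x l ih => rw [shuf_cons, contr_const, ih]; simp [contr_apply]

/-- A linear map as a form of degree one. -/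
def ofLinear (t : V →ₗ[ℝ] P) : ListForm V P :=
  ⟨fun l => match l with
    | [] => 0
    | x :: l => const (t x) l,
    by
      rintro (_ | ⟨x, _ | ⟨y, l₁⟩⟩) (_ | ⟨z, l₂⟩) <;> simp [const],
    by
      rintro (_ | ⟨x, _ | ⟨y, l₁⟩⟩) (_ | ⟨z, l₂⟩) <;> simp [const]⟩

theorem ofLinear_nil (t : V →ₗ[ℝ] P) : (ofLinear t).1 [] = 0 := rfl

theorem contr_ofLinear (t : V →ₗ[ℝ] P) (x : V) : contr x (ofLinear t).1 = const (t x) := rfl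

theorem gradeInv_ofLinear (t : V →ₗ[ℝ] P) : gradeInv (ofLinear t).1 = -(ofLinear t).1 := by
  funext l
  rcases l with _ | ⟨x, _ | ⟨y, l⟩⟩ <;> simp [gradeInv_apply, ofLinear, const]

theorem hasParity_ofLinear (t : V →ₗ[ℝ] P) : HasParity 1 (ofLinear t).1 := by
  rw [HasParity, gradeInv_ofLinear, pow_one, neg_one_smul]

theorem shuf_ofLinear_cons (B : P →ₗ[ℝ] Q →ₗ[ℝ] R) (t : V →ₗ[ℝ] P) (g : List V → Q) (x : V)
    (l : List V) :
    shuf B (ofLinear t).1 g (x :: l) = B (t x) (g l) - shuf B (ofLinear t).1 (contr x g) l := by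
  rw [shuf_cons, contr_ofLinear, shuf_const_left, gradeInv_ofLinear, map_neg, LinearMap.neg_apply,
    Pi.neg_apply, sub_eq_add_neg]

theorem ofLinear_sub (t u : V →ₗ[ℝ] P) :
    (ofLinear (t - u)).1 = (ofLinear t).1 - (ofLinear u).1 := by
  funext l
  rcases l with _ | ⟨x, _ | ⟨y, l⟩⟩ <;> simp [ofLinear, const]

theorem insertion_ofLinear_id (φ : ListForm V V) : insertion φ (ofLinear LinearMap.id) = φ := by
  apply Subtype.ext
  have h : (curryHead (ofLinear (LinearMap.id : V →ₗ[ℝ] V))).1 = const LinearMap.id := by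
    funext l
    ext v
    cases l <;> rfl
  funext l
  change shuf _ _ _ l = _
  rw [h, shuf_const_right]
  rfl

/-- Alternation, in the form of antisymmetry in neighbouring arguments. -/
def IsAlt (s : List V → W) : Prop :=
  ∀ l₁ x y l₂, s (l₁ ++ x :: y :: l₂) = -s (l₁ ++ y :: x :: l₂)

theorem IsAlt.contr {s : List V → W} (hs : IsAlt s) (x : V) : IsAlt (contr x s) :=
  fun l₁ => hs (x :: l₁)

/-- The contraction of a multilinear form. -/
def contrForm (x : V) (s : ListForm V W) : ListForm V W := ⟨contr x s.1, contr_mem s.2 x⟩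

theorem contr_curryHead {s : ListForm V W} (hs : IsAlt s.1) (x : V) :
    contr x (curryHead s).1 = -(curryHead (contrForm x s)).1 := by
  funext l
  ext v
  exact hs [] v x l

/-- For alternating `s`, the derivation extending `t` and `δW` is `δW ∘ s - i_t s`. -/
theorem insertion_ofLinear (t : V →ₗ[ℝ] V) (δW : W →ₗ[ℝ] W) {s : ListForm V W}
    (hs : IsAlt s.1) (l : List V) :
    (insertion (ofLinear t) s).1 l = δW (s.1 l) - der t δW s.1 l := by
  induction l generalizing s with
  | nil =>
    change shuf _ _ _ [] = _
    simp [shuf_nil, ofLinear_nil, der]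
  | cons x l ih =>
    have h := ih (s := contrForm x s) (hs.contr x)
    change shuf LinearMap.applyₗ (ofLinear t).1 (curryHead (contrForm x s)).1 l = _ at h
    change shuf LinearMap.applyₗ (ofLinear t).1 (curryHead s).1 (x :: l) = _
    rw [shuf_ofLinear_cons, contr_curryHead hs, map_neg, Pi.neg_apply, h]
    change s.1 (t x :: l) - -(δW (s.1 (x :: l)) - der t δW (contr x s.1) l) =
      δW (s.1 (x :: l)) - (der t δW (contr x s.1) l - s.1 (t x :: l))
    abel

theorem shuf_ofLinear_comp (t : V →ₗ[ℝ] V) (g : List V → V →ₗ[ℝ] W) :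
    shuf LinearMap.applyₗ (ofLinear LinearMap.id).1 (fun l => g l ∘ₗ t) =
      shuf LinearMap.applyₗ (ofLinear t).1 g := by
  funext l
  induction l generalizing g with
  | nil => simp [shuf_nil, ofLinear_nil]
  | cons x l ih =>
    rw [shuf_ofLinear_cons, shuf_ofLinear_cons, ← ih]
    rfl

/-- For a torsion-free connection on `V`, the covariant exterior derivative is `∇_φ` for the
identity `φ`, regarded as a form of degree one. Here `β` is the bracket, as a form of degree two. -/
theorem covAlong_id {D : V →ₗ[ℝ] V →ₗ[ℝ] V} (DW : V →ₗ[ℝ] W →ₗ[ℝ] W) {br : V →ₗ[ℝ] V →ₗ[ℝ] V}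
    (hD : ∀ x y, D x y - D y x = br x y) {β : List V → V} (hβ0 : β [] = 0)
    (hβ : ∀ x, contr x β = (ofLinear (br x)).1) {s : ListForm V W} (hs : IsAlt s.1) :
    (covAlong D DW (ofLinear LinearMap.id) s).1 =
      shuf DW (ofLinear LinearMap.id).1 s.1 - shuf LinearMap.applyₗ β (curryHead s).1 := by
  have hβ1 : gradeInv β = β := by
    funext l
    cases l with
    | nil => simp [gradeInv_apply, hβ0]
    | cons x l =>
      have h := congrFun (contr_gradeInv x β) l
      rw [hβ, gradeInv_ofLinear, neg_neg, ← hβ] at h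
      exact h
  funext l
  induction l generalizing s with
  | nil =>
    change shuf _ _ _ [] = _
    simp [shuf_nil, ofLinear_nil, hβ0]
  | cons x l ih =>
    have h := ih (s := contrForm x s) (hs.contr x)
    change shuf LinearMap.applyₗ _ (covD D DW (contrForm x s)).1 l = _ at h
    change shuf LinearMap.applyₗ _ (covD D DW s).1 (x :: l) = _
    have h1 : contr x (covD D DW s).1 = (covD D DW (contrForm x s)).1 -
        fun l => (curryHead s).1 l ∘ₗ D.flip x := by
      funext l
      ext v
      rfl
    have h2 : br x = D x - D.flip x := by
      ext y
      exact (hD x y).symm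
    have h3 := insertion_ofLinear (D x) (DW x) hs l
    change shuf LinearMap.applyₗ (ofLinear (D x)).1 (curryHead s).1 l = _ at h3
    rw [shuf_ofLinear_cons, h1, map_sub, Pi.sub_apply, h, shuf_ofLinear_comp, Pi.sub_apply,
      Pi.sub_apply, shuf_ofLinear_cons, shuf_cons, hβ, hβ1, contr_curryHead hs, h2, ofLinear_sub,
      map_sub, LinearMap.sub_apply, Pi.sub_apply, h3, map_neg, Pi.neg_apply]
    change der (D x) (DW x) s.1 l - _ = DW x (s.1 l) - shuf DW _ (contr x s.1) l - _
    simp only [contrForm]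
    abel

end ListForms

/-! ### Sums over shuffles as signed shuffle products -/

namespace ListForms
open LieAlgebroidForms

/-- The permutation of `Fin (n + 1)` that fixes `0` and acts as `τ` on the other indices. -/
def fixZero {n : ℕ} (τ : Perm (Fin n)) : Perm (Fin (n + 1)) := Equiv.Perm.decomposeFin.symm (0, τ)

theorem fixZero_zero {n : ℕ} (τ : Perm (Fin n)) : fixZero τ 0 = 0 := by simp [fixZero]

theorem fixZero_succ {n : ℕ} (τ : Perm (Fin n)) (i : Fin n) : fixZero τ i.succ = (τ i).succ := by
  simp [fixZero]

theorem sign_fixZero {n : ℕ} (τ : Perm (Fin n)) :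
    Equiv.Perm.sign (fixZero τ) = Equiv.Perm.sign τ := by
  simp [fixZero]

theorem fixZero_injective {n : ℕ} : Function.Injective (fixZero (n := n)) := fun σ τ h => by
  simpa using Equiv.Perm.decomposeFin.symm.injective h

theorem exists_eq_fixZero {n : ℕ} {σ : Perm (Fin (n + 1))} (h : σ 0 = 0) :
    ∃ τ, σ = fixZero τ := by
  obtain ⟨⟨i, τ⟩, rfl⟩ := Equiv.Perm.decomposeFin.symm.surjective σ
  rw [Equiv.Perm.decomposeFin_symm_apply_zero] at h
  exact ⟨τ, by rw [h]; rfl⟩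

theorem isShuffle_fixZero {n : ℕ} (p : ℕ) (τ : Perm (Fin n)) :
    IsShuffle (p + 1) (fixZero τ) ↔ IsShuffle p τ := by
  simp only [IsShuffle, Fin.forall_fin_succ, fixZero_zero, fixZero_succ, Fin.succ_lt_succ_iff,
    Fin.val_succ, Fin.val_zero]
  simp

/-- The permutations `σ` with `σ p = 0` are the products `fixZero τ * cycleRange p`; such a product
is a shuffle exactly if `τ` is one. -/
theorem isShuffle_fixZero_mul_cycleRange {n : ℕ} (p : Fin (n + 1)) (τ : Perm (Fin n)) :
    IsShuffle p (fixZero τ * Fin.cycleRange p) ↔ IsShuffle p τ := by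
  have h1 : ∀ i : Fin n, (p.succAbove i).val < p.val ↔ i.val < p.val := fun i => by
    rw [← Fin.lt_def, Fin.succAbove_lt_iff_castSucc_lt, Fin.lt_def, Fin.val_castSucc]
  have h2 : ∀ i : Fin n, p.val ≤ (p.succAbove i).val ↔ p.val ≤ i.val := fun i => by
    rw [← not_lt, h1, not_lt]
  simp only [IsShuffle, Fin.forall_iff_succAbove p, Equiv.Perm.mul_apply, Fin.cycleRange_self,
    Fin.cycleRange_succAbove, fixZero_zero, fixZero_succ, Fin.succ_lt_succ_iff,
    Fin.succAbove_lt_succAbove_iff, h1, h2]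
  have h3 : ∀ i : Fin n, p.succAbove i < p → ¬ p.val ≤ i.val := fun i h =>
    not_le.2 ((h1 i).1 h)
  constructor
  · rintro ⟨⟨-, h⟩, -, h'⟩
    exact ⟨fun i => (h i).2, fun i => (h' i).2⟩
  · rintro ⟨h, h'⟩
    refine ⟨⟨⟨by simp, fun i hi hi' => ?_⟩, fun i => ⟨by simp, h i⟩⟩,
      ⟨by simp, by simp⟩, fun i => ⟨fun hi hi' => absurd hi' (h3 i hi), h' i⟩⟩
    have : p.val < (p.succAbove i).val := hi
    have := (h1 i).2 hi'
    omega

section Sum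

variable {N : Type*} [AddCommMonoid N]

/-- The shuffles whose first block starts with `0`. -/
theorem sum_shuffles_fst {p q n : ℕ} (h : p + q = n) (h' : p + 1 + q = n + 1)
    (G : Perm (Fin (n + 1)) → N) :
    ∑ σ ∈ shuffles (p + 1) q h' with σ 0 = 0, G σ = ∑ τ ∈ shuffles p q h, G (fixZero τ) := by
  symm
  refine Finset.sum_bij (fun τ _ => fixZero τ) ?_ (fun _ _ _ _ h => fixZero_injective h) ?_
    fun _ _ => rfl
  · intro τ hτ
    simpa [shuffles, isShuffle_fixZero, fixZero_zero] using hτ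
  · intro σ hσ
    obtain ⟨τ, rfl⟩ := exists_eq_fixZero (Finset.mem_filter.1 hσ).2
    refine ⟨τ, ?_, rfl⟩
    simpa [shuffles, isShuffle_fixZero, fixZero_zero] using hσ

/-- The shuffles whose second block starts with `0`. -/
theorem sum_shuffles_snd {p q n : ℕ} (h : p + q = n) (h' : p + (q + 1) = n + 1)
    (G : Perm (Fin (n + 1)) → N) :
    ∑ σ ∈ shuffles p (q + 1) h' with σ ⟨p, by omega⟩ = 0, G σ =
      ∑ τ ∈ shuffles p q h, G (fixZero τ * Fin.cycleRange ⟨p, by omega⟩) := by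
  symm
  refine Finset.sum_bij (fun τ _ => fixZero τ * Fin.cycleRange ⟨p, by omega⟩) ?_
    (fun _ _ _ _ h => fixZero_injective (mul_right_cancel h)) ?_ fun _ _ => rfl
  · intro τ hτ
    have := isShuffle_fixZero_mul_cycleRange ⟨p, by omega⟩ τ
    simpa [shuffles, this, fixZero_zero] using hτ
  · intro σ hσ
    have h0 : (σ * (Fin.cycleRange ⟨p, by omega⟩)⁻¹ : Perm (Fin (n + 1))) 0 = 0 := by
      rw [Equiv.Perm.mul_apply, show (Fin.cycleRange ⟨p, by omega⟩)⁻¹ 0 = ⟨p, by omega⟩ by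
        rw [Equiv.Perm.inv_eq_iff_eq, Fin.cycleRange_self]]
      exact (Finset.mem_filter.1 hσ).2
    obtain ⟨τ, hτ⟩ := exists_eq_fixZero h0
    have e : σ = fixZero τ * Fin.cycleRange ⟨p, by omega⟩ := by rw [← hτ]; simp
    rw [e] at hσ
    have := isShuffle_fixZero_mul_cycleRange ⟨p, by omega⟩ τ
    refine ⟨τ, ?_, e.symm⟩
    simpa [shuffles, this, fixZero_zero] using hσ

/-- The index `0` is the image of the first index of one of the two blocks. -/
theorem IsShuffle.apply_eq_zero {p n : ℕ} {σ : Perm (Fin (n + 1))} (hσ : IsShuffle p σ)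
    (hp : p < n + 1) : σ 0 = 0 ∨ σ ⟨p, hp⟩ = 0 := by
  obtain ⟨i, hi⟩ := σ.surjective 0
  by_cases h : i.val < p
  · left
    by_contra h0
    have h1 : i ≠ 0 := fun h2 => h0 (h2 ▸ hi)
    have := hσ.1 0 i (Fin.pos_iff_ne_zero.2 h1) h
    rw [hi] at this
    exact absurd this (Fin.not_lt_zero _)
  · right
    by_contra h0
    have h1 : i ≠ ⟨p, hp⟩ := fun h2 => h0 (h2 ▸ hi)
    have h2 : (⟨p, hp⟩ : Fin (n + 1)) < i := lt_of_le_of_ne (not_lt.1 h) h1.symm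
    have := hσ.2 _ i h2 le_rfl
    rw [hi] at this
    exact absurd this (Fin.not_lt_zero _)

theorem sum_shuffles_succ_succ {p q n : ℕ} (h : p + 1 + (q + 1) = n + 1)
    (G : Perm (Fin (n + 1)) → N) :
    ∑ σ ∈ shuffles (p + 1) (q + 1) h, G σ =
      ∑ τ ∈ shuffles p (q + 1) (by omega), G (fixZero τ) +
        ∑ τ ∈ shuffles (p + 1) q (by omega),
          G (fixZero τ * Fin.cycleRange ⟨p + 1, by omega⟩) := by
  rw [← Finset.sum_filter_add_sum_filter_not _ fun σ => σ 0 = 0,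
    sum_shuffles_fst (by omega : p + (q + 1) = n), ← sum_shuffles_snd _ h]
  congr 1
  refine Finset.sum_congr (Finset.filter_congr fun σ hσ => ?_) fun _ _ => rfl
  have hs : IsShuffle (p + 1) σ := by simpa [shuffles] using hσ
  constructor
  · exact (IsShuffle.apply_eq_zero hs (by omega)).resolve_left
  · intro h1 h0
    have := σ.injective (h0.trans h1.symm)
    simp [Fin.ext_iff] at this

theorem sum_shuffles_succ_zero {p n : ℕ} (h : p + 1 + 0 = n + 1) (G : Perm (Fin (n + 1)) → N) :
    ∑ σ ∈ shuffles (p + 1) 0 h, G σ = ∑ τ ∈ shuffles p 0 (by omega), G (fixZero τ) := by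
  rw [← sum_shuffles_fst (by omega : p + 0 = n) h, Finset.filter_true_of_mem]
  intro σ hσ
  have hs : IsShuffle (p + 1) σ := by simpa [shuffles] using hσ
  obtain ⟨i, hi⟩ := σ.surjective 0
  by_contra h0
  have h1 : i ≠ 0 := fun h2 => h0 (h2 ▸ hi)
  have := hs.1 0 i (Fin.pos_iff_ne_zero.2 h1) (by omega)
  rw [hi] at this
  exact absurd this (Fin.not_lt_zero _)

theorem sum_shuffles_zero_succ {q n : ℕ} (h : 0 + (q + 1) = n + 1)
    (G : Perm (Fin (n + 1)) → N) :
    ∑ σ ∈ shuffles 0 (q + 1) h, G σ =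
      ∑ τ ∈ shuffles 0 q (by omega), G (fixZero τ * Fin.cycleRange ⟨0, by omega⟩) := by
  rw [← sum_shuffles_snd (by omega : 0 + q = n) h, Finset.filter_true_of_mem]
  intro σ hσ
  have hs : IsShuffle 0 σ := by simpa [shuffles] using hσ
  exact (or_self_iff.1 (IsShuffle.apply_eq_zero hs (by omega)))

end Sum

variable {V N W : Type*} [AddCommGroup V] [Module ℝ V] [AddCommGroup N] [Module ℝ N]
  [AddCommGroup W] [Module ℝ W]

/-- The family `n ↦ b(n)(x, …)` for a linear family `b` of alternating maps. -/
def contrFamily {q : ℕ} (x : V) (b : N →ₗ[ℝ] V [⋀^Fin (q + 1)]→ₗ[ℝ] W) :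
    N →ₗ[ℝ] V [⋀^Fin q]→ₗ[ℝ] W :=
  LinearMap.applyₗ x ∘ₗ AlternatingMap.curryLeftLinearMap ∘ₗ b

/-- A summand of a shuffle sum in which the first argument `x` goes into `a`. -/
theorem term_fixZero {p q n : ℕ} (h : p + q = n) (h' : p + 1 + q = n + 1)
    (a : V [⋀^Fin (p + 1)]→ₗ[ℝ] N) (b : N →ₗ[ℝ] V [⋀^Fin q]→ₗ[ℝ] W) (x : V) (Z : Fin n → V)
    (τ : Perm (Fin n)) :
    (Equiv.Perm.sign (fixZero τ) • b (a fun i => Matrix.vecCons (n := n) x Z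
        (fixZero τ (fstIdx h' i)))
        fun j => Matrix.vecCons (n := n) x Z (fixZero τ (sndIdx h' j))) =
      Equiv.Perm.sign τ •
        b (a.curryLeft x fun i => Z (τ (fstIdx h i))) fun j => Z (τ (sndIdx h j)) := by
  have h1 : (fun i => Matrix.vecCons (n := n) x Z (fixZero τ (fstIdx h' i))) =
      Matrix.vecCons x fun i => Z (τ (fstIdx h i)) := by
    funext i
    induction i using Fin.cases with
    | zero =>
      rw [show fstIdx h' 0 = 0 from rfl, fixZero_zero]; rfl
    | succ i =>
      rw [show fstIdx h' i.succ = (fstIdx h i).succ from rfl, fixZero_succ]; rfl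
  have h2 : (fun j => Matrix.vecCons (n := n) x Z (fixZero τ (sndIdx h' j))) =
      fun j => Z (τ (sndIdx h j)) := by
    funext j
    rw [show sndIdx h' j = (sndIdx h j).succ from Fin.ext (by simp [sndIdx]; omega), fixZero_succ]
    rfl
  rw [sign_fixZero, h1, h2]
  rfl

/-- A summand of a shuffle sum in which the first argument `x` goes into `b`; the sign is that of
the cycle moving `x` past the `p` arguments of `a`. -/
theorem term_fixZero_mul_cycleRange {p q n : ℕ} (h : p + q = n) (h' : p + (q + 1) = n + 1)
    (a : V [⋀^Fin p]→ₗ[ℝ] N) (b : N →ₗ[ℝ] V [⋀^Fin (q + 1)]→ₗ[ℝ] W) (x : V) (Z : Fin n → V)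
    (τ : Perm (Fin n)) (hp : p < n + 1) :
    (Equiv.Perm.sign (fixZero τ * Fin.cycleRange ⟨p, hp⟩) •
      b (a fun i => Matrix.vecCons (n := n) x Z
          ((fixZero τ * Fin.cycleRange ⟨p, hp⟩ : Perm _) (fstIdx h' i)))
        fun j => Matrix.vecCons (n := n) x Z
          ((fixZero τ * Fin.cycleRange ⟨p, hp⟩ : Perm _) (sndIdx h' j))) =
      (-1 : ℝ) ^ p • Equiv.Perm.sign τ •
        contrFamily x b (a fun i => Z (τ (fstIdx h i))) fun j => Z (τ (sndIdx h j)) := by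
  have h1 : (fun i => Matrix.vecCons (n := n) x Z
      ((fixZero τ * Fin.cycleRange ⟨p, hp⟩ : Perm _) (fstIdx h' i))) =
      fun i => Z (τ (fstIdx h i)) := by
    funext i
    have : fstIdx h' i = (⟨p, hp⟩ : Fin (n + 1)).succAbove (fstIdx h i) := by
      rw [Fin.succAbove_of_castSucc_lt _ _ (by simp [Fin.lt_def, fstIdx])]
      rfl
    rw [this, Equiv.Perm.mul_apply, Fin.cycleRange_succAbove, fixZero_succ]
    rfl
  have h2 : (fun j => Matrix.vecCons (n := n) x Z
      ((fixZero τ * Fin.cycleRange ⟨p, hp⟩ : Perm _) (sndIdx h' j))) =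
      Matrix.vecCons x fun j => Z (τ (sndIdx h j)) := by
    funext j
    induction j using Fin.cases with
    | zero =>
      rw [show sndIdx h' 0 = ⟨p, hp⟩ from rfl, Equiv.Perm.mul_apply, Fin.cycleRange_self,
        fixZero_zero]
      rfl
    | succ j =>
      have : sndIdx h' j.succ = (⟨p, hp⟩ : Fin (n + 1)).succAbove (sndIdx h j) := by
        rw [Fin.succAbove_of_le_castSucc _ _ (by simp [Fin.le_def, sndIdx])]
        rfl
      rw [this, Equiv.Perm.mul_apply, Fin.cycleRange_succAbove, fixZero_succ]
      rfl
  rw [h1, h2, Equiv.Perm.sign_mul, Fin.sign_cycleRange, sign_fixZero]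
  change _ = (-1 : ℝ) ^ p • Equiv.Perm.sign τ • b _ (Matrix.vecCons x _)
  rcases Nat.even_or_odd p with hp | hp <;> simp [hp.neg_one_pow]

theorem curryLeft_shuffleSum_succ_succ {p q n : ℕ} (h : p + 1 + (q + 1) = n + 1)
    (a : V [⋀^Fin (p + 1)]→ₗ[ℝ] N) (b : N →ₗ[ℝ] V [⋀^Fin (q + 1)]→ₗ[ℝ] W) (x : V) :
    (shuffleSum h a b).curryLeft x = shuffleSum (by omega) (a.curryLeft x) b +
      (-1 : ℝ) ^ (p + 1) • shuffleSum (by omega) a (contrFamily x b) := by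
  ext Z
  rw [AlternatingMap.curryLeft_apply_apply, AlternatingMap.add_apply, AlternatingMap.smul_apply,
    shuffleSum_apply, shuffleSum_apply, shuffleSum_apply, sum_shuffles_succ_succ, Finset.smul_sum]
  congr 1
  · exact Finset.sum_congr rfl fun τ _ => term_fixZero _ _ a b x Z τ
  · exact Finset.sum_congr rfl fun τ _ => term_fixZero_mul_cycleRange _ _ a b x Z τ _

theorem curryLeft_shuffleSum_succ_zero {p n : ℕ} (h : p + 1 + 0 = n + 1)
    (a : V [⋀^Fin (p + 1)]→ₗ[ℝ] N) (b : N →ₗ[ℝ] V [⋀^Fin 0]→ₗ[ℝ] W) (x : V) :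
    (shuffleSum h a b).curryLeft x = shuffleSum (by omega) (a.curryLeft x) b := by
  ext Z
  rw [AlternatingMap.curryLeft_apply_apply, shuffleSum_apply, shuffleSum_apply,
    sum_shuffles_succ_zero]
  exact Finset.sum_congr rfl fun τ _ => term_fixZero _ _ a b x Z τ

theorem curryLeft_shuffleSum_zero_succ {q n : ℕ} (h : 0 + (q + 1) = n + 1)
    (a : V [⋀^Fin 0]→ₗ[ℝ] N) (b : N →ₗ[ℝ] V [⋀^Fin (q + 1)]→ₗ[ℝ] W) (x : V) :
    (shuffleSum h a b).curryLeft x = shuffleSum (by omega) a (contrFamily x b) := by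
  ext Z
  rw [AlternatingMap.curryLeft_apply_apply, shuffleSum_apply, shuffleSum_apply,
    sum_shuffles_zero_succ]
  refine Finset.sum_congr rfl fun τ _ => ?_
  rw [term_fixZero_mul_cycleRange (by omega) h a b x Z τ, pow_zero, one_smul]

/-- An alternating `k`-linear map, as a function on lists that vanishes on lists of length other
than `k`. -/
def ofAltAux : (k : ℕ) → (V [⋀^Fin k]→ₗ[ℝ] W) → List V → W
  | 0, a, l => const (a ![]) l
  | _ + 1, _, [] => 0
  | k + 1, a, x :: l => ofAltAux k (a.curryLeft x) l

theorem ofAltAux_add {k : ℕ} (a b : V [⋀^Fin k]→ₗ[ℝ] W) (l : List V) :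
    ofAltAux k (a + b) l = ofAltAux k a l + ofAltAux k b l := by
  induction k generalizing l with
  | zero => cases l <;> simp [ofAltAux, const]
  | succ k ih => cases l <;> simp [ofAltAux, ih]

theorem ofAltAux_smul {k : ℕ} (c : ℝ) (a : V [⋀^Fin k]→ₗ[ℝ] W) (l : List V) :
    ofAltAux k (c • a) l = c • ofAltAux k a l := by
  induction k generalizing l with
  | zero => cases l <;> simp [ofAltAux, const]
  | succ k ih => cases l <;> simp [ofAltAux, ih]

theorem ofAltAux_mem {k : ℕ} (a : V [⋀^Fin k]→ₗ[ℝ] W) : ofAltAux k a ∈ ListForm V W := by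
  induction k with
  | zero => exact ⟨by rintro (_ | _) <;> simp [ofAltAux, const],
      by rintro (_ | _) <;> simp [ofAltAux, const]⟩
  | succ k ih =>
    constructor
    · rintro (_ | ⟨x, l₁⟩) l₂ v w
      · simp [ofAltAux, ofAltAux_add]
      · exact (ih (a.curryLeft x)).1 l₁ l₂ v w
    · rintro (_ | ⟨x, l₁⟩) l₂ c v
      · simp [ofAltAux, ofAltAux_smul]
      · exact (ih (a.curryLeft x)).2 l₁ l₂ c v

/-- An alternating `k`-linear map, as a multilinear form that vanishes in degrees other than `k`. -/
def ofAlt (k : ℕ) : (V [⋀^Fin k]→ₗ[ℝ] W) →ₗ[ℝ] ListForm V W where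
  toFun a := ⟨ofAltAux k a, ofAltAux_mem a⟩
  map_add' a b := Subtype.ext (funext (ofAltAux_add a b))
  map_smul' c a := Subtype.ext (funext (ofAltAux_smul c a))

theorem ofAlt_zero_val (a : V [⋀^Fin 0]→ₗ[ℝ] W) : (ofAlt 0 a).1 = const (a ![]) := rfl

theorem ofAlt_succ_nil {k : ℕ} (a : V [⋀^Fin (k + 1)]→ₗ[ℝ] W) : (ofAlt (k + 1) a).1 [] = 0 := rfl

theorem contr_ofAlt {k : ℕ} (a : V [⋀^Fin (k + 1)]→ₗ[ℝ] W) (x : V) :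
    contr x (ofAlt (k + 1) a).1 = (ofAlt k (a.curryLeft x)).1 := rfl

theorem ofAlt_ofFn {k : ℕ} (a : V [⋀^Fin k]→ₗ[ℝ] W) (Z : Fin k → V) :
    (ofAlt k a).1 (List.ofFn Z) = a Z := by
  induction k with
  | zero =>
    rw [List.ofFn_zero]
    exact congrArg a (Subsingleton.elim _ _)
  | succ k ih =>
    rw [List.ofFn_succ]
    refine (ih (a.curryLeft (Z 0)) fun i => Z i.succ).trans (congrArg a ?_)
    exact Fin.cons_self_tail Z

theorem ofAlt_of_length_ne {k : ℕ} (a : V [⋀^Fin k]→ₗ[ℝ] W) {l : List V} (h : l.length ≠ k) :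
    (ofAlt k a).1 l = 0 := by
  induction k generalizing l with
  | zero =>
    cases l with
    | nil => exact absurd rfl h
    | cons x l => rfl
  | succ k ih =>
    cases l with
    | nil => rfl
    | cons x l => exact ih (a.curryLeft x) fun h' => h (by rw [List.length_cons, h'])

theorem hasParity_ofAlt {k : ℕ} (a : V [⋀^Fin k]→ₗ[ℝ] W) : HasParity k (ofAlt k a).1 := by
  funext l
  by_cases h : l.length = k
  · rw [gradeInv_apply, h]; rfl
  · rw [gradeInv_apply, Pi.smul_apply, ofAlt_of_length_ne a h, smul_zero, smul_zero]

theorem isAlt_ofAlt {k : ℕ} (a : V [⋀^Fin k]→ₗ[ℝ] W) : IsAlt (ofAlt k a).1 := by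
  intro l₁ x y l₂
  induction k generalizing l₁ with
  | zero => cases l₁ <;> simp [ofAlt_zero_val, const]
  | succ k ih =>
    cases l₁ with
    | cons z l₁ => exact ih (a.curryLeft z) l₁
    | nil =>
      cases k with
      | zero => exact neg_zero.symm
      | succ k =>
        change (ofAlt k ((a.curryLeft x).curryLeft y)).1 l₂ =
          -(ofAlt k ((a.curryLeft y).curryLeft x)).1 l₂
        have h : (a.curryLeft y).curryLeft x + (a.curryLeft x).curryLeft y = 0 := by
          have h1 := a.curryLeft_same (x + y)
          simpa only [map_add, AlternatingMap.curryLeft_add, LinearMap.add_apply,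
            AlternatingMap.curryLeft_same, zero_add, add_zero] using h1
        rw [eq_neg_of_add_eq_zero_right h, map_neg]
        rfl

/-- The sum over shuffles is the signed shuffle product. -/
theorem ofAlt_shuffleSum {p q n : ℕ} (h : p + q = n) (a : V [⋀^Fin p]→ₗ[ℝ] N)
    (b : N →ₗ[ℝ] V [⋀^Fin q]→ₗ[ℝ] W) {g : List V → N →ₗ[ℝ] W}
    (hg : ∀ l v, g l v = (ofAlt q (b v)).1 l) :
    (ofAlt n (shuffleSum h a b)).1 = shuf LinearMap.applyₗ (ofAlt p a).1 g := by
  funext l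
  induction n generalizing p q g l with
  | zero =>
    obtain rfl : p = 0 := by omega
    obtain rfl : q = 0 := by omega
    cases l with
    | nil =>
      rw [shuf_nil, ofAlt_zero_val, ofAlt_zero_val]
      change shuffleSum h a b ![] = g [] (a ![])
      have hu : shuffles 0 0 h = {1} := by
        ext σ
        simp [shuffles, IsShuffle, Subsingleton.elim σ 1]
      rw [hg, ofAlt_zero_val, shuffleSum_apply, hu, Finset.sum_singleton, Equiv.Perm.sign_one,
        one_smul]
      exact congrArg₂ (fun v w => b (a v) w) (Subsingleton.elim _ _) (Subsingleton.elim _ _)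
    | cons x l =>
      have hg0 : contr x g = 0 := funext fun l => LinearMap.ext fun v => hg _ _
      rw [shuf_cons, hg0, ofAlt_zero_val, ofAlt_zero_val, contr_const]
      simp [const]
  | succ n ih =>
    cases l with
    | nil =>
      rw [shuf_nil, ofAlt_succ_nil]
      cases p with
      | succ p => rw [ofAlt_succ_nil, map_zero, LinearMap.zero_apply]
      | zero =>
        obtain rfl : q = n + 1 := by omega
        exact (hg [] _).symm
    | cons x l =>
      have hpar : gradeInv (ofAlt p a).1 = (-1 : ℝ) ^ p • (ofAlt p a).1 := hasParity_ofAlt a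
      change contr x (ofAlt (n + 1) (shuffleSum h a b)).1 l = _
      rw [contr_ofAlt, shuf_cons, hpar, map_smul, LinearMap.smul_apply, Pi.smul_apply]
      cases p with
      | zero =>
        obtain rfl : q = n + 1 := by omega
        rw [curryLeft_shuffleSum_zero_succ, ofAlt_zero_val, contr_const, map_zero, pow_zero,
          one_smul]
        refine (ih (by omega) a (contrFamily x b) (g := contr x g) (fun l v => hg (x :: l) v)
          l).trans (zero_add _).symm
      | succ p =>
        rw [contr_ofAlt]
        cases q with
        | zero =>
          have hg0 : contr x g = 0 := funext fun l => LinearMap.ext fun v => hg _ _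
          rw [curryLeft_shuffleSum_succ_zero, hg0, map_zero, Pi.zero_apply, smul_zero]
          exact (ih (by omega) _ b hg l).trans (add_zero _).symm
        | succ q =>
          rw [curryLeft_shuffleSum_succ_succ, map_add, map_smul]
          have h1 := ih (by omega : p + (q + 1) = n) (a.curryLeft x) b hg l
          have h2 := ih (by omega : p + 1 + q = n) a (contrFamily x b) (g := contr x g)
            (fun l v => hg (x :: l) v) l
          rw [← h1, ← h2]
          rfl

end ListForms

/-! ### Forms on a Lie algebroid -/

namespace ListForms

section
variable {V N W : Type*} [AddCommGroup V] [Module ℝ V] [AddCommGroup N] [Module ℝ N]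
  [AddCommGroup W] [Module ℝ W]

theorem ofAlt_compAlternatingMap {k : ℕ} (t : N →ₗ[ℝ] W) (a : V [⋀^Fin k]→ₗ[ℝ] N) (l : List V) :
    (ofAlt k (t.compAlternatingMap a)).1 l = t ((ofAlt k a).1 l) := by
  induction k generalizing l with
  | zero => cases l <;> simp [ofAlt_zero_val, const]
  | succ k ih =>
    cases l with
    | nil => simp [ofAlt_succ_nil]
    | cons x l => exact ih (a.curryLeft x) l

theorem ofAlt_ofSubsingleton (t : V →ₗ[ℝ] W) :
    ofAlt 1 (AlternatingMap.ofSubsingleton ℝ V W (0 : Fin 1) t) = ofLinear t := by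
  apply Subtype.ext
  funext l
  cases l <;> rfl

theorem curryHead_ofAlt_zero (a : V [⋀^Fin 0]→ₗ[ℝ] W) : curryHead (ofAlt 0 a) = 0 := rfl

end

end ListForms

noncomputable section
namespace LieAlgebroidForms
open ListForms

variable {EM : Type*} [NormedAddCommGroup EM] [NormedSpace ℝ EM] [FiniteDimensional ℝ EM]
  {H : Type*} [TopologicalSpace H] {I : ModelWithCorners ℝ EM H}
  {M : Type*} [TopologicalSpace M] [T2Space M] [ChartedSpace H M] [IsManifold I ∞ M]
  {F : Type*} [NormedAddCommGroup F] [NormedSpace ℝ F] [FiniteDimensional ℝ F]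
  {A : M → Type*} [TopologicalSpace (Bundle.TotalSpace F A)]
  [∀ x, AddCommGroup (A x)] [∀ x, Module ℝ (A x)] [∀ x, TopologicalSpace (A x)]
  [FiberBundle F A] [VectorBundle ℝ F A] [ContMDiffVectorBundle ∞ F A I]
  {F' : Type*} [NormedAddCommGroup F'] [NormedSpace ℝ F']
  {E : M → Type*} [TopologicalSpace (Bundle.TotalSpace F' E)]
  [∀ x, AddCommGroup (E x)] [∀ x, Module ℝ (E x)] [∀ x, TopologicalSpace (E x)]
  [FiberBundle F' E] [VectorBundle ℝ F' E]
  {L : LieAlgebroid I F A}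

/-- The values of a form on sections, as a linear map in the form. -/
def onSectionsLin (k : ℕ) :
    Forms I F A F' E k →ₗ[ℝ] (Sec I F A [⋀^Fin k]→ₗ[ℝ] Sec I F' E) where
  toFun := onSections
  map_add' _ _ := rfl
  map_smul' _ _ := rfl

/-- An element of `Ω^*(A, E)` as a family of multilinear maps on sections. -/
def toListForm : AllForms I F A F' E →ₗ[ℝ] ListForm (Sec I F A) (Sec I F' E) :=
  liftForms fun k => ofAlt k ∘ₗ onSectionsLin k

theorem toListForm_ofForm {k : ℕ} (η : Forms I F A F' E k) :
    toListForm (ofForm k η) = ofAlt k (onSections η) := liftForms_ofForm _ _ _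

theorem toListForm_ofFn {k : ℕ} (η : AllForms I F A F' E) (Z : Fin k → Sec I F A) :
    (toListForm η).1 (List.ofFn Z) =
      onSections (DirectSum.component ℝ ℕ (fun k => Forms I F A F' E k) k η) Z := by
  let f : AllForms I F A F' E →ₗ[ℝ] Sec I F' E :=
    LinearMap.proj (List.ofFn Z) ∘ₗ (ListForm (Sec I F A) (Sec I F' E)).subtype ∘ₗ toListForm
  let g : AllForms I F A F' E →ₗ[ℝ] Sec I F' E :=
    { toFun := fun T => T Z, map_add' := fun _ _ => rfl, map_smul' := fun _ _ => rfl :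
      (Sec I F A [⋀^Fin k]→ₗ[ℝ] Sec I F' E) →ₗ[ℝ] Sec I F' E } ∘ₗ
        onSectionsLin k ∘ₗ DirectSum.component ℝ ℕ (fun k => Forms I F A F' E k) k
  have h : f = g := by
    apply allForms_hom_ext
    intro j θ
    change (toListForm (ofForm j θ)).1 (List.ofFn Z) =
      onSections (DirectSum.component ℝ ℕ (fun k => Forms I F A F' E k) k
        (DirectSum.lof ℝ ℕ (fun k => Forms I F A F' E k) j θ)) Z
    rw [toListForm_ofForm]
    by_cases hj : j = k
    · subst hj
      rw [DirectSum.component.lof_self, ofAlt_ofFn]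
    · rw [ofAlt_of_length_ne _ (by rw [List.length_ofFn]; exact Ne.symm hj),
        DirectSum.component.of, dif_neg hj]
      rfl
  exact LinearMap.congr_fun h η

theorem toListForm_injective :
    Function.Injective (toListForm : AllForms I F A F' E →ₗ[ℝ] _) := by
  intro η θ h
  refine DirectSum.ext_component ℝ fun k => ?_
  apply forms_ext
  ext1 Z
  rw [← toListForm_ofFn, ← toListForm_ofFn, h]

theorem onSections_insertForm {p k : ℕ} (φ : Forms I F A F A p)
    (ψ : Forms I F A F' E (k + 1)) :
    onSections (insertForm φ ψ) = shuffleSum rfl (onSections φ) (onSections ψ).curryLeft := by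
  ext Z x
  change (insertForm φ ψ).1 x (fun i => Z i x) = evalAt (I := I) (F := F') (A := E) x _
  rw [insertForm_apply, shuffleSum_apply, map_sum]
  refine Finset.sum_congr rfl fun σ _ => ?_
  rw [Units.smul_def, Units.smul_def, map_zsmul]
  congr 1
  change ψ.1 x _ = ψ.1 x _
  congr 1
  funext j
  refine Fin.cases ?_ (fun j => ?_) j <;> rfl

theorem toListForm_insertOp (Φ : AllForms I F A F A) (η : AllForms I F A F' E) :
    toListForm (insertOp Φ η) = insertion (toListForm Φ) (toListForm η) := by
  have h : ∀ (p : ℕ) (φ : Forms I F A F A p), toListForm ∘ₗ insertOp (ofForm p φ) =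
      insertion (toListForm (ofForm p φ)) ∘ₗ
        (toListForm : AllForms I F A F' E →ₗ[ℝ] _) := by
    intro p φ
    apply allForms_hom_ext
    rintro k η
    rw [LinearMap.comp_apply, LinearMap.comp_apply, insertOp, liftForms_ofForm]
    change toListForm (liftForms _ (ofForm k η)) = _
    rw [liftForms_ofForm, toListForm_ofForm, toListForm_ofForm]
    cases k with
    | zero =>
      apply Subtype.ext
      change _ = shuf LinearMap.applyₗ _ (curryHead _).1
      rw [curryHead_ofAlt_zero]
      simp
    | succ k =>
      change toListForm (ofForm (p + k) (insertForm φ η)) = _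
      rw [toListForm_ofForm, onSections_insertForm]
      exact Subtype.ext (ofAlt_shuffleSum rfl _ _ fun l v => rfl)
  have h' : toListForm ∘ₗ insertOp.flip η = insertion.flip (toListForm η) ∘ₗ toListForm :=
    allForms_hom_ext fun p φ => LinearMap.congr_fun (h p φ) η
  exact LinearMap.congr_fun h' Φ

/-- For torsion-free `∇` on `A`, the operator `d^∇` is `∇_φ` for `φ` the identity of `A`. -/
theorem toListForm_extDerivOp {nabA : AConnection F A L} (h_tors : nabA.TorsionFree)
    (nabE : AConnection F' E L) (η : AllForms I F A F' E) :
    toListForm (extDerivOp nabE η) =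
      covAlong nabA.cov nabE.cov (ofLinear LinearMap.id) (toListForm η) := by
  have h : toListForm ∘ₗ extDerivOp nabE =
      covAlong nabA.cov nabE.cov (ofLinear LinearMap.id) ∘ₗ toListForm := by
    apply allForms_hom_ext
    intro k η
    rw [LinearMap.comp_apply, LinearMap.comp_apply, extDerivOp, liftForms_ofForm,
      LinearMap.comp_apply, toListForm_ofForm, toListForm_ofForm, onSections_extDeriv, map_sub]
    apply Subtype.ext
    rw [covAlong_id nabE.cov h_tors (β := (ofAlt 2 L.bracketAlt).1) rfl _ (isAlt_ofAlt _)]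
    · refine congrArg₂ (· - ·) ?_ ?_
      · refine (ofAlt_shuffleSum _ _ _
          (g := fun l => nabE.cov.flip ((ofAlt k (onSections η)).1 l)) fun l v => ?_).trans ?_
        · exact (ofAlt_compAlternatingMap (nabE.cov v) (onSections η) l).symm
        · rw [ofAlt_ofSubsingleton]
          funext l
          exact (shuf_natural LinearMap.id nabE.cov.flip LinearMap.id (B := nabE.cov)
            (fun _ _ => rfl) _ _ l).symm
      · cases k with
        | zero =>
          rw [curryHead_ofAlt_zero]
          change (ofAlt 1 0).1 = _
          simp
        | succ k => exact ofAlt_shuffleSum _ _ _ fun l v => rfl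
    · intro x
      funext l
      rcases l with _ | ⟨y, _ | ⟨z, l⟩⟩ <;> rfl
  exact LinearMap.congr_fun h η

/-- The defining formula of `∇_φ` amounts to inserting `φ` into the covariant derivative. -/
theorem toListForm_nablaOp {nabA : AConnection F A L} (h_tors : nabA.TorsionFree)
    (nabE : AConnection F' E L) (Φ : AllForms I F A F A) (η : AllForms I F A F' E) :
    toListForm (nablaOp nabA nabE Φ η) =
      covAlong nabA.cov nabE.cov (toListForm Φ) (toListForm η) := by
  have h : ∀ (p : ℕ) (φ : Forms I F A F A p), toListForm ∘ₗ nablaOp nabA nabE (ofForm p φ) =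
      covAlong nabA.cov nabE.cov (toListForm (ofForm p φ)) ∘ₗ
        (toListForm : AllForms I F A F' E →ₗ[ℝ] _) := by
    intro p φ
    ext1 η
    have hins : ∀ q (θ : Forms I F A F A q) (η : AllForms I F A F' E),
        toListForm (insertHom q θ η) = insertion (toListForm (ofForm q θ)) (toListForm η) := by
      intro q θ η
      rw [← toListForm_insertOp, insertOp, liftForms_ofForm]
    have hd : toListForm (ofForm (p + 1) (extDeriv nabA p φ)) =
        covAlong nabA.cov nabA.cov (ofLinear LinearMap.id) (toListForm (ofForm p φ)) := by
      rw [← toListForm_extDerivOp h_tors, extDerivOp, liftForms_ofForm]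
      rfl
    have hpar : HasParity p (toListForm (ofForm p φ)).1 := by
      rw [toListForm_ofForm]
      exact hasParity_ofAlt _
    have key := covAlong_insertion_comm nabA.cov nabE.cov
      (hasParity_ofLinear (LinearMap.id : Sec I F A →ₗ[ℝ] Sec I F A)) hpar (toListForm η)
    -- As `i_φ id = φ`, the last term of the commutator formula is `∇_φ`; solve for it.
    rw [insertion_ofLinear_id] at key
    rw [LinearMap.comp_apply, LinearMap.comp_apply, nablaOp, liftForms_ofForm]
    change toListForm (insertHom p φ (extDerivOp nabE η) - (-1 : ℝ) ^ (((p : ℤ) - 1) * 1) •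
      extDerivOp nabE (insertHom p φ η) - (-1 : ℝ) ^ p • insertHom (p + 1) (extDeriv nabA p φ) η) =
      _
    rw [map_sub, map_sub, map_smul, map_smul, hins, hins, toListForm_extDerivOp h_tors,
      toListForm_extDerivOp h_tors, hins, hd, mul_one, zpow_sub_one₀ (by norm_num), zpow_natCast]
    rw [one_mul, pow_succ] at key
    rcases Nat.even_or_odd p with hp | hp
    · rw [hp.neg_one_pow] at key ⊢
      rw [show (1 : ℝ) * (-1)⁻¹ = -1 by norm_num]
      linear_combination (norm := module) key
    · rw [hp.neg_one_pow] at key ⊢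
      rw [show (-1 : ℝ) * (-1)⁻¹ = 1 by norm_num]
      linear_combination (norm := module) (-1 : ℝ) • key
  have h' : toListForm ∘ₗ (nablaOp nabA nabE).flip η =
      (covAlong nabA.cov nabE.cov).flip (toListForm η) ∘ₗ toListForm :=
    allForms_hom_ext fun p φ => LinearMap.congr_fun (h p φ) η
  exact LinearMap.congr_fun h' Φ

end LieAlgebroidForms

end

open LieAlgebroidForms in
theorem theorem1
    {EM : Type*} [NormedAddCommGroup EM] [NormedSpace ℝ EM] [FiniteDimensional ℝ EM]
    {H : Type*} [TopologicalSpace H] (I : ModelWithCorners ℝ EM H)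
    {M : Type*} [TopologicalSpace M] [T2Space M] [ChartedSpace H M] [IsManifold I ∞ M]
    (F : Type*) [NormedAddCommGroup F] [NormedSpace ℝ F] [FiniteDimensional ℝ F]
    (A : M → Type*) [TopologicalSpace (Bundle.TotalSpace F A)]
    [∀ x, AddCommGroup (A x)] [∀ x, Module ℝ (A x)] [∀ x, TopologicalSpace (A x)]
    [FiberBundle F A] [VectorBundle ℝ F A] [ContMDiffVectorBundle ∞ F A I]
    (F' : Type*) [NormedAddCommGroup F'] [NormedSpace ℝ F'] [FiniteDimensional ℝ F']
    (E : M → Type*) [TopologicalSpace (Bundle.TotalSpace F' E)]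
    [∀ x, AddCommGroup (E x)] [∀ x, Module ℝ (E x)] [∀ x, TopologicalSpace (E x)]
    [FiberBundle F' E] [VectorBundle ℝ F' E] [ContMDiffVectorBundle ∞ F' E I]
    (L : LieAlgebroid I F A)
    (nabA : AConnection F A L) (h_tors : nabA.TorsionFree)
    (nabE : AConnection F' E L)
    (k l : ℕ) (φ : Forms I F A F A k) (ψ : Forms I F A F A l) :
    gradedComm (k : ℤ) ((l : ℤ) - 1)
        (nablaOp nabA nabE (ofForm k φ)) (insertOp (ofForm l ψ)) =
      (insertOp (nablaOp nabA nabA (ofForm k φ) (ofForm l ψ)) :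
          Module.End ℝ (AllForms I F A F' E)) -
        (-1 : ℝ) ^ ((k : ℤ) * ((l : ℤ) - 1)) •
          nablaOp nabA nabE (insertOp (ofForm l ψ) (ofForm k φ)) := by
  have hpar : ∀ q (θ : Forms I F A F A q), ListForms.HasParity q (toListForm (ofForm q θ)).1 := by
    intro q θ
    rw [toListForm_ofForm]
    exact ListForms.hasParity_ofAlt _
  have hsign : (-1 : ℝ) ^ ((k : ℤ) * ((l : ℤ) - 1)) = (-1) ^ (k * l + k) := by
    rw [show (k : ℤ) * ((l : ℤ) - 1) = ((k * l + k : ℕ) : ℤ) - 2 * k by push_cast; ring,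
      zpow_sub₀ (by norm_num), zpow_natCast, zpow_mul]
    norm_num
  refine LinearMap.ext fun η => toListForm_injective ?_
  have key :=
    ListForms.covAlong_insertion_comm nabA.cov nabE.cov (hpar k φ) (hpar l ψ) (toListForm η)
  change toListForm (nablaOp nabA nabE (ofForm k φ) (insertOp (ofForm l ψ) η) -
    (-1 : ℝ) ^ ((k : ℤ) * ((l : ℤ) - 1)) •
      insertOp (ofForm l ψ) (nablaOp nabA nabE (ofForm k φ) η)) =
    toListForm (insertOp (nablaOp nabA nabA (ofForm k φ) (ofForm l ψ)) η -
      (-1 : ℝ) ^ ((k : ℤ) * ((l : ℤ) - 1)) •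
        nablaOp nabA nabE (insertOp (ofForm l ψ) (ofForm k φ)) η)
  simp only [map_sub, map_smul, toListForm_nablaOp h_tors, toListForm_insertOp, hsign]
  exact key
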